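/- **One-point functions of XY chiral eigenstates.** *Setting.* Let $N\ge 2$ be even and $\tau\in i\mathbb R_{>0}$, $q=e^{i\pi\tau}$, and let $\theta_1(u)=2\sum_{n\ge0}(-1)^nq^{(n+1/2)^2}\sin((2n+1)\pi u)$, $\theta_2(u)=2\sum_{n\ge0}q^{(n+1/2)^2}\cos((2n+1)\pi u)$, $\theta_3(u)=1+2\sum_{n\ge1}q^{n^2}\cos(2n\pi u)$, $\theta_4(u)=1+2\sum_{n\ge1}(-1)^nq^{n^2}\cos(2n\pi u)$. Put $J_x=\theta_3(0)/\theta_4(0)$, $J_y=\theta_4(0)/\theta_3(0)$, $\epsilon_n=(-1)^n$, $$r(u)=\frac{\theta_1(u+\frac14)}{\theta_1(u-\frac14)},\qquad R(u)=\frac{\theta_3(u+\frac14)}{\theta_3(u-\frac14)},\qquad \mathcal A_n(u)=r(u)^n\left[\frac{\theta_3(u+\frac{\epsilon_n}4)}{\theta_3(u-\frac{\epsilon_n}4)}\right]^{1/2}$$ (principal square root). On $(\mathbb C^2)^{\otimes N}$ let $\sigma_n^\alpha$ be the Pauli matrix $\sigma^\alpha$ acting on the $n$-th factor, and for $\kappa=\pm1$,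 $1\le n_1<\dots<n_M\le N$ let $$|\kappa;\mathbf n\rangle=(-i)^{\sum_j n_j}\bigotimes_{l=1}^N\psi\bigl(l-2\,\#\{j:n_j<l\}-\kappa\bigr),\qquad \psi(v)=\tfrac1{\sqrt2}\binom{1}{i^{v}} .$$ Let $0\le M\le N$ with $M\equiv N/2 \pmod 2$ and $\xi\in\{0,1\}$. Let $\mathbf u=(u_1,\dots,u_M)$ be pairwise distinct solutions of the Bethe equations $r(u_j)^N=(-1)^{\xi+1}$ in the union of the rectangles $\{-\frac12<\operatorname{Re}u\le0,\ -\frac{\operatorname{Im}\tau}2<\operatorname{Im}u\le\frac{\operatorname{Im}\tau}2\}$ and $\{0<\operatorname{Re}u\le\frac12,\ -\frac{\operatorname{Im}\tau}2\le\operatorname{Im}u<\frac{\operatorname{Im}\tau}2\}$, and let $$|\Psi_M(\mathbf u)\rangle=\sum_{1\le n_1<\dots<n_M\le N}\ \sum_{\kappa=\pm1}\frac{\kappa^\xi}{\sqrt{2N^M}}\det_{j,l}\bigl\{\mathcal A_{n_j}(u_l)\bigr\}\,|\kappa;\mathbf n\rangle$$ be the corresponding chiral eigenstate of the XY chain. Write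 $\langle A\rangle=\langle\Psi_M(\mathbf u)|A|\Psi_M(\mathbf u)\rangle$. For $u=u_l$ let $p(u)\in(-\frac\pi2,\frac{3\pi}2]$ be the quasi-momentum, $e^{ip(u)}=r(u)$, and $$\mathcal X(u,\pm1)=\frac{4J_y^{\pm1}\sin(2p(u))}{\mathcal E(u)},\qquad \mathcal E(u)=2\frac{\theta_2(0)}{\theta_1'(0)}\left[\frac{\theta_1'(u-\frac14)}{\theta_1(u-\frac14)}-\frac{\theta_1'(u+\frac14)}{\theta_1(u+\frac14)}\right].$$ *Claim.* The real numbers $p_l=p(u_l)$ exist, $\mathcal X(u_l,\pm1)=i\bigl[\frac1{r(u_l)R(u_l)^{\pm1}}-r(u_l)R(u_l)^{\pm1}\bigr]$ for all $l$, and: 1. $\langle\sigma_n^x\rangle=\langle\sigma_n^y\rangle=0$ for $1\le n\le N$; more generally $\langle\sigma_{j_1}^{\alpha_1}\sigma_{j_2}^{\alpha_2}\cdots\sigma_{j_{2k+1}}^{\alpha_{2k+1}}\rangle=0$ for all $k\ge0$, all sites $j_1,\dots,j_{2k+1}$ and all $\alpha_i\in\{x,y\}$. 2. For $1\le n\le N$,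 $$\langle\sigma_n^z\rangle=\frac1N\sum_{l=1}^M\mathcal X(u_l,(-1)^n)=\frac{J_y^{\epsilon_n}}N\sum_{l=1}^M\pm\frac{\sin(2p_l)}{\sqrt{\cos^2p_l+\bigl(\frac{J_x-J_y}2\bigr)^2}},$$ where the sign is $+$ for $p_l\in(-\frac\pi2,\frac\pi2]$ and $-$ for $p_l\in(\frac\pi2,\frac{3\pi}2]$. 3. $\langle\sigma_n^z\rangle$ depends only on the parity of $n$. -/

import Mathlib

noncomputable section

namespace XYChain

/-! ### Jacobi theta functions with rescaled argument and nome `q = exp (i π τ)` -/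

/-- `θ₁(u) = 2 ∑ (-1)^n q^((n+1/2)^2) sin ((2n+1) π u)`. -/
def theta1 (τ u : ℂ) : ℂ :=
  2 * ∑' n : ℕ, (-1) ^ n * Complex.exp (Complex.I * Real.pi * τ * ((n : ℂ) + 1 / 2) ^ 2) *
    Complex.sin ((2 * n + 1) * Real.pi * u)

/-- `θ₂(u) = 2 ∑ q^((n+1/2)^2) cos ((2n+1) π u)`. -/
def theta2 (τ u : ℂ) : ℂ :=
  2 * ∑' n : ℕ, Complex.exp (Complex.I * Real.pi * τ * ((n : ℂ) + 1 / 2) ^ 2) *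
    Complex.cos ((2 * n + 1) * Real.pi * u)

/-- `θ₃(u) = 1 + 2 ∑_{n ≥ 1} q^(n^2) cos (2 n π u)`. -/
def theta3 (τ u : ℂ) : ℂ :=
  1 + 2 * ∑' n : ℕ, Complex.exp (Complex.I * Real.pi * τ * ((n : ℂ) + 1) ^ 2) *
    Complex.cos (2 * (n + 1) * Real.pi * u)

/-- `θ₄(u) = 1 + 2 ∑_{n ≥ 1} (-1)^n q^(n^2) cos (2 n π u)`. -/
def theta4 (τ u : ℂ) : ℂ :=
  1 + 2 * ∑' n : ℕ, (-1) ^ (n + 1) *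
    Complex.exp (Complex.I * Real.pi * τ * ((n : ℂ) + 1) ^ 2) *
    Complex.cos (2 * (n + 1) * Real.pi * u)

/-- The exchange constant `J_x = θ₃(0) / θ₄(0)`. -/
def couplingX (τ : ℂ) : ℂ := theta3 τ 0 / theta4 τ 0

/-- The exchange constant `J_y = θ₄(0) / θ₃(0)`. -/
def couplingY (τ : ℂ) : ℂ := theta4 τ 0 / theta3 τ 0

/-! ### Spin operators on `(ℂ²)^{⊗N}`

Vectors are given by their coordinates in the product basis: a basis state is `s : Fin N → Fin 2`
with `0` for spin up and `1` for spin down. The element `n : Fin N` is the site with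
label `n + 1 ∈ {1, …, N}`. -/

/-- The label in `{1, …, N}` of a site. -/
def label {N : ℕ} (n : Fin N) : ℕ := (n : ℕ) + 1

/-- `ε_n = (-1)^n`, where `n` is the label of the site. -/
def parity {N : ℕ} (n : Fin N) : ℤ := (-1) ^ label n

inductive Axis
  | x
  | y
  | z

/-- The Pauli matrices. -/
def pauli : Axis → Matrix (Fin 2) (Fin 2) ℂ
  | Axis.x => !![0, 1; 1, 0]
  | Axis.y => !![0, -Complex.I; Complex.I, 0]
  | Axis.z => !![1, 0; 0, -1]

/-- `σ_n^α`: the Pauli matrix acting on the `n`th tensor factor, the identity on all others. -/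
def sigma {N : ℕ} (α : Axis) (n : Fin N) : Matrix (Fin N → Fin 2) (Fin N → Fin 2) ℂ :=
  Matrix.of fun s t => pauli α (s n) (t n) * ∏ m ∈ Finset.univ.erase n, if s m = t m then 1 else 0

/-- `⟨Ψ| A |Ψ⟩`. -/
def expectation {N : ℕ} (A : Matrix (Fin N → Fin 2) (Fin N → Fin 2) ℂ)
    (Ψ : (Fin N → Fin 2) → ℂ) : ℂ :=
  star Ψ ⬝ᵥ A.mulVec Ψ

/-! ### The chiral basis -/

/-- The local state `ψ(u) = (1, i^u) / √2`. -/
def localState (u : ℤ) : Fin 2 → ℂ :=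
  ![1 / (Real.sqrt 2 : ℂ), Complex.I ^ u / (Real.sqrt 2 : ℂ)]

/-- The chiral basis vector `|κ; n₁, …, n_M⟩`: up to the phase `(-i)^(n₁ + ⋯ + n_M)` it is
the product state whose factor at site `l` is `ψ(l - 2k - κ)`, where `k` is the number of
kink positions `n_j < l`. -/
def chiralVector {N M : ℕ} (κ : ℤ) (n : Fin M → Fin N) : (Fin N → Fin 2) → ℂ :=
  fun s => (-Complex.I) ^ (∑ j, label (n j)) *
    ∏ l : Fin N, localState
      ((label l : ℤ) - 2 * ((Finset.univ.filter fun j => n j < l).card : ℤ) - κ) (s l)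

/-! ### Bethe roots, amplitudes and Bethe vectors -/

/-- `r(u) = θ₁(u + 1/4) / θ₁(u - 1/4)`. -/
def r (τ u : ℂ) : ℂ := theta1 τ (u + 1 / 4) / theta1 τ (u - 1 / 4)

/-- `R(u) = θ₃(u + 1/4) / θ₃(u - 1/4)`. -/
def R (τ u : ℂ) : ℂ := theta3 τ (u + 1 / 4) / theta3 τ (u - 1 / 4)

/-- The set to which Bethe roots are restricted: the union of the two rectangles
`-1/2 < Re u ≤ 0`, `-Im τ / 2 < Im u ≤ Im τ / 2` and
`0 < Re u ≤ 1/2`, `-Im τ / 2 ≤ Im u < Im τ / 2`. -/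
def rootDomain (τ : ℂ) : Set ℂ :=
  {u | (-(1 / 2) < u.re ∧ u.re ≤ 0 ∧ -(τ.im / 2) < u.im ∧ u.im ≤ τ.im / 2) ∨
    (0 < u.re ∧ u.re ≤ 1 / 2 ∧ -(τ.im / 2) ≤ u.im ∧ u.im < τ.im / 2)}

/-- The Bethe root tuples: pairwise distinct solutions `u_j` of `r(u_j)^N = (-1)^(ξ+1)`
in the root domain. -/
structure IsBetheTuple (τ : ℂ) (N ξ : ℕ) {M : ℕ} (u : Fin M → ℂ) : Prop where
  injective : Function.Injective u
  mem_domain : ∀ j, u j ∈ rootDomain τ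
  bethe_eq : ∀ j, r τ (u j) ^ N = (-1) ^ (ξ + 1)

/-- `M` is admissible for a chain of even length `N`: `0 ≤ M ≤ N`, and `M` has the same parity
as `N / 2`. -/
def Admissible (N M : ℕ) : Prop := M ≤ N ∧ M ≡ N / 2 [MOD 2]

/-- The one-particle amplitude `𝒜_n(u) = r(u)^n [θ₃(u + ε_n/4) / θ₃(u - ε_n/4)]^(1/2)` at the site
`n`, with the principal branch of the square root. -/
def amplitude {N : ℕ} (τ : ℂ) (n : Fin N) (u : ℂ) : ℂ :=
  r τ u ^ label n *
    (theta3 τ (u + (parity n : ℂ) / 4) / theta3 τ (u - (parity n : ℂ) / 4)) ^ (1 / 2 : ℂ)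

/-- `χ_n(u) = (2 N^M)^(-1/2) det (𝒜_{n_j}(u_l))`. -/
def chi {N M : ℕ} (τ : ℂ) (u : Fin M → ℂ) (n : Fin M → Fin N) : ℂ :=
  1 / (Real.sqrt (2 * (N : ℝ) ^ M) : ℂ) *
    Matrix.det (Matrix.of fun j l : Fin M => amplitude τ (n j) (u l))

open Classical in
/-- The chiral Bethe vector
`|Ψ_M(u)⟩ = ∑_{1 ≤ n₁ < ⋯ < n_M ≤ N} ∑_{κ = ±1} χ_n(u) κ^ξ |κ; n⟩`. -/
def betheVector (τ : ℂ) (N ξ : ℕ) {M : ℕ} (u : Fin M → ℂ) : (Fin N → Fin 2) → ℂ :=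
  ∑ n ∈ (Finset.univ : Finset (Fin M → Fin N)).filter (fun n => StrictMono n),
    ∑ κ ∈ ({1, -1} : Finset ℤ), (chi τ u n * (κ : ℂ) ^ ξ) • chiralVector κ n

/-! ### Quasi-momentum, one-particle energy and magnetization function -/

/-- The quasi-momentum: the representative in `(-π/2, 3π/2]` of the argument of `r(u)`. -/
def momentum (τ u : ℂ) : ℝ :=
  toIocMod Real.two_pi_pos (-(Real.pi / 2)) (Complex.arg (r τ u))

/-- The sign that is `+` on `(-π/2, π/2]` and `-` on `(π/2, 3π/2]`. -/
def bandSign (p : ℝ) : ℝ := if p ≤ Real.pi / 2 then 1 else -1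

/-- `ℰ(u) = 2 (θ₂(0) / θ₁'(0)) [θ₁'(u - 1/4) / θ₁(u - 1/4) - θ₁'(u + 1/4) / θ₁(u + 1/4)]`. -/
def energy (τ u : ℂ) : ℂ :=
  2 * (theta2 τ 0 / deriv (theta1 τ) 0) *
    (deriv (theta1 τ) (u - 1 / 4) / theta1 τ (u - 1 / 4) -
      deriv (theta1 τ) (u + 1 / 4) / theta1 τ (u + 1 / 4))

/-- `𝒳(u, ε) = 4 J_y^ε sin (2 p(u)) / ℰ(u)` for `ε = ±1`. -/
def magX (τ u : ℂ) (ε : ℤ) : ℂ :=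
  4 * couplingY τ ^ ε * (Real.sin (2 * momentum τ u) : ℂ) / energy τ u

end XYChain

end

namespace XYChain

open Complex Real ComplexConjugate

/-! Transversal components. For a fixed kink set the states κ = 1 and κ = -1 are exchanged by ∏ σ^z,
because shifting the argument of ψ by 2 changes the sign of its lower component. Weighting κ by κ^ξ
therefore makes the Bethe vector an eigenvector of ∏ σ^z with eigenvalue (-1)^ξ
(`spinParity_of_betheVector_ne_zero`). A product of an odd number of σ^x, σ^y reverses this
eigenvalue, so its expectation vanishes.

Longitudinal component. The local states of two chiral basis vectors at a given site are equal up to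
phase or orthogonal, and σ^z interchanges the two possibilities. Hence σ_n^z has a nonzero matrix
element only between vectors whose kink sets differ exactly at n and its cyclic predecessor m; with
the number M of kinks fixed, it hops one kink between m and n. When the kink crosses the boundary,
the phases, the sign of the re-sorting and the flip of κ combine, thanks to M ≡ N/2 mod 2, into
(-1)^(ξ+1), the sign in the Bethe equations (`IsPrev.phase`). So σ_n^z acts as a free-fermion
hopping term plus its adjoint. The amplitudes of distinct Bethe roots are orthogonal with squared
norm N (`IsBetheTuple.sum_conj_amplitude_mul`), and Cauchy–Binet reduces the expectation in the
Slater determinant to a sum over one-particle states (`sum_conj_det_mul_det_update`). The ratio of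
neighbouring amplitudes is a unimodular w = 1/(r R^ε), and hopping plus adjoint contributes i(w -
1/w) for each root.

Theta functions. It remains to identify i(w - 1/w) with 𝒳. Product formulas from modulus τ to 2τ
(`jacobiTheta₂_mul`) turn statements about r and R into statements about theta functions at 2u.
Since |r| = 1, positivity on the imaginary axis and a modular transformation force every Bethe root
onto Re u = 0 or Re u = 1/2 (`exists_isAxisPoint`). On these lines r ± 1/r, R ± 1/R, ℰ, J_x and J_y
are explicit in a few theta values (`IsAxisPoint.exists_values`), and both formulas for 𝒳 become
algebra. -/

/-! ### Theta series as bilateral sums, and half-period shifts -/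

lemma theta3_eq (τ u : ℂ) (hτ : 0 < τ.im) : theta3 τ u = jacobiTheta₂ u τ := by
  have h := hasSum_jacobiTheta₂_term u hτ
  have hs := h.summable
  have h1 : Summable fun n : ℕ => jacobiTheta₂_term ((n : ℤ) + 1) u τ :=
    hs.comp_injective (i := fun n : ℕ => (n : ℤ) + 1) fun a b hab => by simpa using hab
  have h2 : Summable fun n : ℕ => jacobiTheta₂_term (-((n : ℤ) + 1)) u τ :=
    hs.comp_injective (i := fun n : ℕ => -((n : ℤ) + 1)) fun a b hab => by simpa using hab
  have h3 := (HasSum.of_add_one_of_neg_add_one (f := fun n : ℤ => jacobiTheta₂_term n u τ)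
    h1.hasSum h2.hasSum).unique h
  rw [← h3, theta3, ← tsum_mul_left, add_right_comm, ← h1.tsum_add h2, add_comm]
  congr 1
  · refine tsum_congr fun n => ?_
    rw [Complex.cos, jacobiTheta₂_term, jacobiTheta₂_term]
    push_cast
    rw [show ∀ a b c : ℂ, 2 * (a * ((b + c) / 2)) = a * b + a * c by intros; ring,
      ← Complex.exp_add, ← Complex.exp_add]
    congr 2 <;> ring
  · simp [jacobiTheta₂_term]

lemma theta2_eq (τ u : ℂ) (hτ : 0 < τ.im) :
    theta2 τ u = cexp (π * I * (τ / 4 + u)) * jacobiTheta₂ (u + τ / 2) τ := by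
  have h := hasSum_jacobiTheta₂_term (u + τ / 2) hτ
  have hs := h.summable
  have h1 : Summable fun n : ℕ => jacobiTheta₂_term (n : ℤ) (u + τ / 2) τ :=
    hs.comp_injective (i := fun n : ℕ => (n : ℤ)) fun a b hab => by simpa using hab
  have h2 : Summable fun n : ℕ => jacobiTheta₂_term (-((n : ℤ) + 1)) (u + τ / 2) τ :=
    hs.comp_injective (i := fun n : ℕ => -((n : ℤ) + 1)) fun a b hab => by simpa using hab
  have h3 := (HasSum.of_nat_of_neg_add_one (f := fun n : ℤ => jacobiTheta₂_term n (u + τ / 2) τ)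
    h1.hasSum h2.hasSum).unique h
  rw [← h3, theta2, ← h1.tsum_add h2, ← tsum_mul_left, ← tsum_mul_left]
  refine tsum_congr fun n => ?_
  rw [Complex.cos, jacobiTheta₂_term, jacobiTheta₂_term]
  push_cast
  rw [mul_add, show ∀ a b c : ℂ, 2 * (a * ((b + c) / 2)) = a * b + a * c by intros; ring,
    ← Complex.exp_add, ← Complex.exp_add, ← Complex.exp_add, ← Complex.exp_add]
  congr 2 <;> ring

lemma theta2_add_half (τ u : ℂ) : theta2 τ (u + 1 / 2) = -theta1 τ u := by
  rw [theta1, theta2, ← mul_neg, ← tsum_neg]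
  congr 1
  refine tsum_congr fun n => ?_
  rw [show (2 * (n : ℂ) + 1) * π * (u + 1 / 2) = (2 * n + 1) * π * u + π / 2 + n * π by ring,
    Complex.cos_antiperiodic.add_nat_mul_eq, Complex.cos_add_pi_div_two]
  ring

lemma theta3_add_half (τ u : ℂ) : theta3 τ (u + 1 / 2) = theta4 τ u := by
  rw [theta3, theta4]
  congr 2
  refine tsum_congr fun n => ?_
  rw [show 2 * ((n : ℂ) + 1) * π * (u + 1 / 2) = 2 * (n + 1) * π * u + (n + 1 : ℕ) * π by
    push_cast; ring, Complex.cos_antiperiodic.add_nat_mul_eq]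
  ring

lemma theta1_neg (τ u : ℂ) : theta1 τ (-u) = -theta1 τ u := by
  simp [theta1, tsum_neg]

lemma theta2_neg (τ u : ℂ) : theta2 τ (-u) = theta2 τ u := by simp [theta2]

lemma theta3_neg (τ u : ℂ) : theta3 τ (-u) = theta3 τ u := by simp [theta3]

lemma theta4_neg (τ u : ℂ) : theta4 τ (-u) = theta4 τ u := by simp [theta4]

lemma theta3_sub_half (τ u : ℂ) : theta3 τ (u - 1 / 2) = theta4 τ u := by
  rw [← theta3_neg, show -(u - 1 / 2) = -u + 1 / 2 by ring, theta3_add_half, theta4_neg]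

lemma theta4_add_half (τ u : ℂ) : theta4 τ (u + 1 / 2) = theta3 τ u := by
  rw [← theta3_sub_half]; ring_nf

lemma theta4_sub_half (τ u : ℂ) : theta4 τ (u - 1 / 2) = theta3 τ u := by
  rw [← theta3_add_half]; ring_nf

lemma theta2_sub_half (τ u : ℂ) : theta2 τ (u - 1 / 2) = theta1 τ u := by
  rw [← theta2_neg, show -(u - 1 / 2) = -u + 1 / 2 by ring, theta2_add_half, theta1_neg, neg_neg]

lemma theta1_add_half (τ u : ℂ) : theta1 τ (u + 1 / 2) = theta2 τ u := by
  rw [← theta2_sub_half]; ring_nf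

lemma theta1_sub_half (τ u : ℂ) : theta1 τ (u - 1 / 2) = -theta2 τ u := by
  rw [← neg_eq_iff_eq_neg, ← theta2_add_half]; ring_nf

/-! ### Product formulas from modulus τ to modulus 2τ -/

/-- In the double series over (m, n), pairs with m + n even are (a + b, a - b) and the others are (a
+ b + 1, a - b). On each class m² + n² becomes twice a sum of two squares, up to linear terms, so
the series factors again with 2τ in place of τ. All theta identities below are consequences. -/
lemma jacobiTheta₂_mul (x y τ : ℂ) (hτ : 0 < τ.im) :
    jacobiTheta₂ x τ * jacobiTheta₂ y τ =
      jacobiTheta₂ (x + y) (2 * τ) * jacobiTheta₂ (x - y) (2 * τ) +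
      cexp (π * I * (2 * x + τ)) *
        (jacobiTheta₂ (x + y + τ) (2 * τ) * jacobiTheta₂ (x - y + τ) (2 * τ)) := by
  have hτ2 : 0 < (2 * τ).im := by simpa using hτ
  have key : ∀ {σ : ℂ} (_ : 0 < σ.im) (a b : ℂ),
      HasSum (fun p : ℤ × ℤ => jacobiTheta₂_term p.1 a σ * jacobiTheta₂_term p.2 b σ)
        (jacobiTheta₂ a σ * jacobiTheta₂ b σ) := by
    intro σ hσ a b
    have ha := ((summable_jacobiTheta₂_term_iff a σ).2 hσ).norm
    have hb := ((summable_jacobiTheta₂_term_iff b σ).2 hσ).norm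
    have := (summable_mul_of_summable_norm ha hb).hasSum
    rwa [← tsum_mul_tsum_of_summable_norm ha hb] at this
  set g₁ : ℤ × ℤ → ℤ × ℤ := fun p => (p.1 + p.2, p.1 - p.2) with hg₁
  set g₂ : ℤ × ℤ → ℤ × ℤ := fun p => (p.1 + p.2 + 1, p.1 - p.2) with hg₂
  have i₁ : Function.Injective g₁ := by
    rintro ⟨a, b⟩ ⟨c, d⟩ h
    simp only [hg₁, Prod.mk.injEq] at h ⊢
    omega
  have i₂ : Function.Injective g₂ := by
    rintro ⟨a, b⟩ ⟨c, d⟩ h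
    simp only [hg₂, Prod.mk.injEq] at h ⊢
    omega
  have hc : IsCompl (Set.range g₁) (Set.range g₂) := by
    constructor
    · rw [Set.disjoint_left]
      rintro _ ⟨⟨a, b⟩, rfl⟩ ⟨⟨c, d⟩, h⟩
      simp only [hg₁, hg₂, Prod.mk.injEq] at h
      omega
    · rw [codisjoint_iff_le_sup]
      rintro ⟨m, n⟩ -
      rcases Int.even_or_odd (m + n) with ⟨k, hk⟩ | ⟨k, hk⟩
      · exact Or.inl ⟨(k, m - k), by simp only [hg₁, Prod.mk.injEq]; omega⟩
      · exact Or.inr ⟨(k, m - k - 1), by simp only [hg₂, Prod.mk.injEq]; omega⟩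
  set f : ℤ × ℤ → ℂ := fun p => jacobiTheta₂_term p.1 x τ * jacobiTheta₂_term p.2 y τ with hf
  have e₁ : HasSum (fun p : Set.range g₁ => f p)
      (jacobiTheta₂ (x + y) (2 * τ) * jacobiTheta₂ (x - y) (2 * τ)) := by
    rw [i₁.hasSum_range_iff]
    convert key hτ2 (x + y) (x - y) using 1
    funext p
    simp only [hf, hg₁, Function.comp, jacobiTheta₂_term, ← Complex.exp_add]
    congr 1
    push_cast
    ring
  have e₂ : HasSum (fun p : Set.range g₂ => f p) (cexp (π * I * (2 * x + τ)) *
      (jacobiTheta₂ (x + y + τ) (2 * τ) * jacobiTheta₂ (x - y + τ) (2 * τ))) := by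
    rw [i₂.hasSum_range_iff]
    refine Eq.subst (motive := fun F => HasSum F _) (funext fun p => ?_)
      ((key hτ2 (x + y + τ) (x - y + τ)).mul_left (cexp (π * I * (2 * x + τ))))
    simp only [hf, hg₂, Function.comp, jacobiTheta₂_term, ← Complex.exp_add]
    congr 1
    push_cast
    ring
  exact (key hτ x y).unique (HasSum.add_isCompl hc e₁ e₂)

lemma theta3_mul_theta3 (x y τ : ℂ) (hτ : 0 < τ.im) :
    theta3 τ x * theta3 τ y = theta3 (2 * τ) (x + y) * theta3 (2 * τ) (x - y) +
      theta2 (2 * τ) (x + y) * theta2 (2 * τ) (x - y) := by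
  have hτ2 : 0 < (2 * τ).im := by simpa using hτ
  rw [theta3_eq _ _ hτ, theta3_eq _ _ hτ, theta3_eq _ _ hτ2, theta3_eq _ _ hτ2,
    theta2_eq _ _ hτ2, theta2_eq _ _ hτ2, jacobiTheta₂_mul _ _ _ hτ, mul_mul_mul_comm,
    ← Complex.exp_add]
  congr 3 <;> ring_nf

lemma theta2_mul_theta2 (x y τ : ℂ) (hτ : 0 < τ.im) :
    theta2 τ x * theta2 τ y = theta3 (2 * τ) (x + y) * theta2 (2 * τ) (x - y) +
      theta2 (2 * τ) (x + y) * theta3 (2 * τ) (x - y) := by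
  have hτ2 : 0 < (2 * τ).im := by simpa using hτ
  rw [theta3_eq _ _ hτ2, theta3_eq _ _ hτ2, theta2_eq _ _ hτ, theta2_eq _ _ hτ,
    theta2_eq _ _ hτ2, theta2_eq _ _ hτ2, mul_mul_mul_comm, jacobiTheta₂_mul _ _ _ hτ,
    show x + τ / 2 + (y + τ / 2) = x + y + τ by ring,
    show x + τ / 2 - (y + τ / 2) = x - y by ring,
    show x + y + τ + τ = x + y + 2 * τ by ring, jacobiTheta₂_add_left',
    show x + y + 2 * τ / 2 = x + y + τ by ring, show x - y + 2 * τ / 2 = x - y + τ by ring,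
    ← Complex.exp_add, mul_add]
  have h1 : cexp (π * I * (τ / 4 + x) + π * I * (τ / 4 + y)) =
    cexp (π * I * (2 * τ / 4 + (x + y))) := by congr 1; ring
  have h2 : cexp (π * I * (τ / 4 + x) + π * I * (τ / 4 + y)) *
      (cexp (π * I * (2 * (x + τ / 2) + τ)) * cexp (-π * I * (2 * τ + 2 * (x + y)))) =
    cexp (π * I * (2 * τ / 4 + (x - y))) := by
    rw [← Complex.exp_add, ← Complex.exp_add]; congr 1; ring
  rw [← h2, ← h1]
  ring

lemma theta1_mul_theta1 (x y τ : ℂ) (hτ : 0 < τ.im) :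
    theta1 τ x * theta1 τ y = theta3 (2 * τ) (x + y) * theta2 (2 * τ) (x - y) -
      theta2 (2 * τ) (x + y) * theta3 (2 * τ) (x - y) := by
  have h := theta2_mul_theta2 (x - 1 / 2) (y + 1 / 2) τ hτ
  rw [theta2_sub_half, theta2_add_half, show x - 1 / 2 + (y + 1 / 2) = x + y by ring,
    show x - 1 / 2 - (y + 1 / 2) = x - y - 1 / 2 - 1 / 2 by ring, theta3_sub_half,
    theta4_sub_half, theta2_sub_half, theta1_sub_half] at h
  linear_combination -h

/-! ### Positivity and zeros on the imaginary and real axes -/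

lemma eq_im_mul_I {τ : ℂ} (hre : τ.re = 0) : τ = τ.im * I := by
  apply Complex.ext <;> simp [hre]

lemma two_mul_re {τ : ℂ} (hre : τ.re = 0) : (2 * τ).re = 0 := by simp [hre]

lemma two_mul_im_pos {τ : ℂ} (him : 0 < τ.im) : 0 < (2 * τ).im := by simpa using him

lemma theta3_imaginary_pos {τ : ℂ} (hre : τ.re = 0) (him : 0 < τ.im) (y : ℝ) :
    ∃ c : ℝ, 0 < c ∧ theta3 τ (y * I) = c := by
  have h := hasSum_jacobiTheta₂_term (y * I) him
  have e : ∀ n : ℤ, jacobiTheta₂_term n (y * I) τ =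
      ((Real.exp (-2 * π * n * y - π * n ^ 2 * τ.im) : ℝ) : ℂ) := by
    intro n
    rw [jacobiTheta₂_term, eq_im_mul_I hre]
    push_cast
    congr 1
    simp only [ofReal_im, ofReal_re, mul_im, I_im, I_re]
    push_cast
    linear_combination (2 * π * n * y + π * n ^ 2 * τ.im) * I_sq
  simp_rw [e] at h
  have hs : Summable fun n : ℤ => Real.exp (-2 * π * n * y - π * n ^ 2 * τ.im) := by
    exact_mod_cast h.summable
  refine ⟨_, hs.tsum_pos (fun _ => (Real.exp_pos _).le) 0 (Real.exp_pos _), ?_⟩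
  rw [theta3_eq _ _ him, ofReal_tsum, h.tsum_eq]

lemma theta2_imaginary_pos {τ : ℂ} (hre : τ.re = 0) (him : 0 < τ.im) (y : ℝ) :
    ∃ c : ℝ, 0 < c ∧ theta2 τ (y * I) = c := by
  obtain ⟨c, hc, h⟩ := theta3_imaginary_pos hre him (y + τ.im / 2)
  refine ⟨Real.exp (-π * (τ.im / 4 + y)) * c, by positivity, ?_⟩
  rw [theta2_eq _ _ him, ofReal_mul, ← h, theta3_eq _ _ him, ofReal_exp]
  have e := eq_im_mul_I hre
  congr 2
  · conv_lhs => rw [e]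
    push_cast
    linear_combination (π * (τ.im / 4 + y)) * I_sq
  · conv_lhs => rw [e]
    push_cast
    ring

lemma theta1_zero (τ : ℂ) : theta1 τ 0 = 0 := by simp [theta1]

lemma theta4_mul_theta3 {τ : ℂ} (him : 0 < τ.im) (z : ℂ) :
    theta4 τ z * theta3 τ z = theta4 (2 * τ) (2 * z) * theta4 (2 * τ) 0 := by
  have h := theta3_mul_theta3 (z + 1 / 2) z τ him
  rw [theta3_add_half, show z + 1 / 2 + z = 2 * z + 1 / 2 by ring,
    show z + 1 / 2 - z = 0 + 1 / 2 by ring, theta3_add_half, theta3_add_half, theta2_add_half,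
    theta2_add_half, theta1_zero] at h
  rw [h]; ring

lemma theta4_imaginary_pos_of_exp_lt {τ : ℂ} (hre : τ.re = 0) (him : 0 < τ.im) (y : ℝ)
    (h : Real.exp (-(π * (τ.im - 2 * |y|))) < 1 / 3) :
    ∃ c : ℝ, 0 < c ∧ theta4 τ (y * I) = c := by
  set ρ := Real.exp (-(π * (τ.im - 2 * |y|))) with hρ
  have hρ0 : 0 < ρ := Real.exp_pos _
  set g : ℕ → ℝ := fun n => (-1) ^ (n + 1) * Real.exp (-(π * τ.im * (n + 1) ^ 2)) *
    Real.cosh (2 * (n + 1) * π * y) with hg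
  have e : theta4 τ (y * I) = ((1 + 2 * ∑' n, g n : ℝ) : ℂ) := by
    rw [theta4]
    push_cast
    congr 2
    refine tsum_congr fun n => ?_
    simp only [hg]
    push_cast
    rw [← mul_assoc, Complex.cos_mul_I]
    congr 3
    conv_lhs => rw [eq_im_mul_I hre]
    linear_combination (π * τ.im * (n + 1) ^ 2) * I_sq
  have hb : ∀ n, ‖g n‖ ≤ ρ * ρ ^ n := by
    intro n
    simp only [hg]
    rw [norm_mul, norm_mul, norm_pow, norm_neg, norm_one, one_pow, one_mul,
      Real.norm_of_nonneg (Real.exp_pos _).le, Real.norm_of_nonneg (Real.cosh_pos _).le]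
    have h1 : Real.cosh (2 * (n + 1) * π * y) ≤ Real.exp (2 * (n + 1) * π * |y|) := by
      rw [← Real.cosh_abs, abs_mul, abs_of_nonneg (by positivity : 0 ≤ 2 * ((n : ℝ) + 1) * π),
        Real.cosh_eq]
      have : Real.exp (-(2 * (n + 1) * π * |y|)) ≤ Real.exp (2 * (n + 1) * π * |y|) :=
        Real.exp_le_exp.2 (neg_le_self (by positivity))
      linarith
    refine (mul_le_mul_of_nonneg_left h1 (Real.exp_pos _).le).trans ?_
    rw [hρ, ← pow_succ', ← Real.exp_nat_mul, ← Real.exp_add, Real.exp_le_exp]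
    push_cast
    -- Since (n + 1)² exceeds n + 1 by n(n + 1), the n-th term is at most ρ^(n + 1). The condition ρ
    -- < 1/3 is what makes twice the geometric sum smaller than the leading term 1.
    have : 0 ≤ π * τ.im * (n * (n + 1)) := by positivity
    nlinarith
  have hsum := (hasSum_geometric_of_lt_one hρ0.le (by linarith)).mul_left ρ
  have := abs_le.1 (tsum_of_norm_bounded hsum hb)
  refine ⟨_, ?_, e⟩
  have h2 : ρ * (1 - ρ)⁻¹ < 1 / 2 := by
    rw [← div_eq_mul_inv, div_lt_iff₀ (by linarith)]; linarith
  linarith [this.1]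

/-- By `theta4_mul_theta3` and the positivity of θ₃, positivity of θ₄ at (iy, τ) follows from
positivity at (2iy, 2τ) and (0, 2τ). Each doubling doubles the gap Im τ - 2|y|, so after k steps the
gap is large enough for the direct estimate of the series. -/
lemma theta4_imaginary_pos {τ : ℂ} (hre : τ.re = 0) {y : ℝ} (hy : 2 * |y| < τ.im) :
    ∃ c : ℝ, 0 < c ∧ theta4 τ (y * I) = c := by
  have step : ∀ k : ℕ, ∀ {σ : ℂ}, σ.re = 0 → ∀ x : ℝ, 2 * |x| < σ.im →
      Real.log 4 < 2 ^ k * (π * (σ.im - 2 * |x|)) →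
      ∃ c : ℝ, 0 < c ∧ theta4 σ (x * I) = c := by
    intro k
    induction k with
    | zero =>
      intro σ hσ x hx hl
      refine theta4_imaginary_pos_of_exp_lt hσ ((by positivity : 0 ≤ 2 * |x|).trans_lt hx) x ?_
      rw [pow_zero, one_mul] at hl
      calc Real.exp (-(π * (σ.im - 2 * |x|))) ≤ Real.exp (-Real.log 4) :=
            Real.exp_le_exp.2 (neg_le_neg hl.le)
        _ < 1 / 3 := by
            rw [Real.exp_neg, Real.exp_log (by norm_num)]; norm_num
    | succ k ih =>
      intro σ hσ x hx hl
      have hσ0 : 0 < σ.im := (by positivity : 0 ≤ 2 * |x|).trans_lt hx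
      have im2 : (2 * σ).im = 2 * σ.im := by simp
      obtain ⟨c, hc, h1⟩ := ih (σ := 2 * σ) (two_mul_re hσ) (2 * x)
        (by rw [abs_mul, im2, abs_two]; linarith)
        (by rw [abs_mul, im2, abs_two]; rw [pow_succ] at hl; linarith)
      obtain ⟨d, hd, h2⟩ := ih (σ := 2 * σ) (two_mul_re hσ) 0
        (by rw [abs_zero, im2]; linarith)
        (by
          rw [abs_zero, im2]
          rw [pow_succ] at hl
          have : 0 ≤ 2 ^ k * (π * (2 * (2 * |x|))) := by positivity
          linarith)
      obtain ⟨e, he, h3⟩ := theta3_imaginary_pos hσ hσ0 x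
      have h := theta4_mul_theta3 hσ0 (x * I)
      rw [ofReal_mul, mul_assoc, ofReal_ofNat] at h1
      rw [ofReal_zero, zero_mul] at h2
      rw [h1, h2, h3] at h
      refine ⟨c * d / e, by positivity, ?_⟩
      rw [ofReal_div, ofReal_mul, ← h, mul_div_cancel_right₀]
      exact_mod_cast he.ne'
  have hpos : 0 < π * (τ.im - 2 * |y|) := mul_pos Real.pi_pos (by linarith)
  obtain ⟨k, hk⟩ := pow_unbounded_of_one_lt (Real.log 4 / (π * (τ.im - 2 * |y|)))
    (by norm_num : (1 : ℝ) < 2)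
  exact step k hre y hy ((div_lt_iff₀ hpos).1 hk)

lemma theta1_eq_zero_iff {τ : ℂ} (him : 0 < τ.im) (z : ℂ) :
    theta1 τ z = 0 ↔ theta4 τ (z + τ / 2) = 0 := by
  rw [← neg_eq_zero, ← theta2_add_half, ← theta3_add_half, theta2_eq _ _ him,
    theta3_eq _ _ him, mul_eq_zero_iff_left (Complex.exp_ne_zero _), add_right_comm]

lemma theta4_half_period {τ : ℂ} (him : 0 < τ.im) : theta4 τ (τ / 2) = 0 := by
  have := (theta1_eq_zero_iff him 0).1 (theta1_zero τ)
  rwa [zero_add] at this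

lemma theta4_imaginary_nonneg {τ : ℂ} (hre : τ.re = 0) (him : 0 < τ.im) {y : ℝ}
    (hy : 2 * |y| ≤ τ.im) :
    ∃ c : ℝ, 0 ≤ c ∧ theta4 τ (y * I) = c := by
  rcases hy.lt_or_eq with h | h
  · obtain ⟨c, hc, h⟩ := theta4_imaginary_pos hre h
    exact ⟨c, hc.le, h⟩
  · refine ⟨0, le_rfl, ?_⟩
    have e : (y : ℂ) * I = τ / 2 ∨ (y : ℂ) * I = -(τ / 2) := by
      rw [eq_im_mul_I hre, ← h]
      rcases abs_choice y with h' | h' <;> rw [h'] <;> push_cast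
      · left; ring
      · right; ring
    rcases e with e | e <;> simp [e, theta4_neg, theta4_half_period him]

lemma theta1_imaginary_ne_zero {τ : ℂ} (hre : τ.re = 0) (him : 0 < τ.im) {y : ℝ} (h0 : y ≠ 0)
    (hy : |y| < τ.im) :
    theta1 τ (y * I) ≠ 0 := by
  wlog h : y < 0 generalizing y
  · have := this (y := -y) (neg_ne_zero.2 h0) (by rwa [abs_neg])
      (by rcases h0.lt_or_gt with h' | h' <;> [exact absurd h' h; linarith])
    rwa [ofReal_neg, neg_mul, theta1_neg, neg_ne_zero] at this
  rw [abs_of_neg h] at hy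
  rw [Ne, theta1_eq_zero_iff him]
  obtain ⟨c, hc, h'⟩ := theta4_imaginary_pos hre (y := y + τ.im / 2) (by
    have : |y + τ.im / 2| < τ.im / 2 := abs_lt.2 ⟨by linarith, by linarith⟩
    linarith)
  have e : (y : ℂ) * I + τ / 2 = ((y + τ.im / 2 : ℝ) : ℂ) * I := by
    conv_lhs => rw [eq_im_mul_I hre]
    push_cast; ring
  rw [e, h']
  exact_mod_cast hc.ne'

/-- The modular transformation τ ↦ -1/τ exchanges the real and imaginary axes. For -1 < x < 0 it
carries θ₁(x), up to nonzero factors, to θ₄ at an imaginary point inside the strip where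
`theta4_imaginary_pos` applies. -/
lemma theta1_real_ne_zero {τ : ℂ} (hre : τ.re = 0) (him : 0 < τ.im) {x : ℝ} (h0 : x ≠ 0)
    (hx : |x| < 1) : theta1 τ x ≠ 0 := by
  wlog h : x < 0 generalizing x
  · have := this (x := -x) (neg_ne_zero.2 h0) (by rwa [abs_neg])
      (by rcases h0.lt_or_gt with h' | h' <;> [exact absurd h' h; linarith])
    rwa [ofReal_neg, theta1_neg, neg_ne_zero] at this
  rw [abs_of_neg h] at hx
  have hτ0 : τ ≠ 0 := by rintro rfl; simp at him
  have hτ' : ((-1 / τ).im) = 1 / τ.im := by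
    conv_lhs => rw [eq_im_mul_I hre]
    have : -1 / ((τ.im : ℂ) * I) = ((1 / τ.im : ℝ) : ℂ) * I := by
      have : (τ.im : ℂ) ≠ 0 := by exact_mod_cast him.ne'
      push_cast
      field_simp
      simp
    rw [this]; simp
  have hτr : ((-1 / τ).re) = 0 := by
    simp [Complex.div_re, hre]
  have hp : 0 < (-1 / τ).im := by rw [hτ']; positivity
  obtain ⟨c, hc, h'⟩ := theta4_imaginary_pos hτr (y := -((x + 1 / 2) / τ.im)) (by
    rw [hτ', abs_neg, abs_div, abs_of_pos him]
    have : |x + 1 / 2| < 1 / 2 := abs_lt.2 ⟨by linarith, by linarith⟩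
    rw [← mul_div_assoc]
    gcongr
    linarith)
  rw [Ne, theta1_eq_zero_iff him, ← theta3_add_half, theta3_eq _ _ him,
    jacobiTheta₂_functional_equation]
  rw [← theta3_add_half, theta3_eq _ _ hp] at h'
  have e : ((x : ℂ) + τ / 2 + 1 / 2) / τ = ((-((x + 1 / 2) / τ.im) : ℝ) : ℂ) * I + 1 / 2 := by
    rw [add_right_comm, add_div, div_div, mul_comm (2 : ℂ), ← div_div, div_self hτ0]
    congr 1
    conv_lhs => rw [eq_im_mul_I hre]
    have : (τ.im : ℂ) ≠ 0 := by exact_mod_cast him.ne'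
    push_cast
    field_simp
    simp
  rw [e, h']
  have h1 : (-I * τ) ≠ 0 := mul_ne_zero (neg_ne_zero.2 I_ne_zero) hτ0
  have h2 : (-I * τ) ^ (1 / 2 : ℂ) ≠ 0 := by
    rw [Ne, Complex.cpow_eq_zero_iff]; tauto
  have h3 : (c : ℂ) ≠ 0 := by exact_mod_cast hc.ne'
  exact mul_ne_zero (mul_ne_zero (one_div_ne_zero h2) (Complex.exp_ne_zero _)) h3

lemma theta3_conj {τ : ℂ} (hre : τ.re = 0) (him : 0 < τ.im) (u : ℂ) :
    conj (theta3 τ u) = theta3 τ (conj u) := by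
  have : -conj τ = τ := by apply Complex.ext <;> simp [hre]
  rw [theta3_eq _ _ him, theta3_eq _ _ him, jacobiTheta₂_conj, this]

lemma theta2_conj {τ : ℂ} (hre : τ.re = 0) (him : 0 < τ.im) (u : ℂ) :
    conj (theta2 τ u) = theta2 τ (conj u) := by
  have : conj τ = -τ := by apply Complex.ext <;> simp [hre]
  rw [← theta2_neg τ (conj u), theta2_eq _ _ him, theta2_eq _ _ him, map_mul, jacobiTheta₂_conj,
    ← Complex.exp_conj, ← jacobiTheta₂_neg_left]
  simp only [map_mul, map_add, map_div₀, conj_I, this, conj_ofReal, map_ofNat]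
  congr 2 <;> ring

lemma theta1_conj {τ : ℂ} (hre : τ.re = 0) (him : 0 < τ.im) (u : ℂ) :
    conj (theta1 τ u) = theta1 τ (conj u) := by
  have h := theta2_conj hre him (u - 1 / 2)
  rw [theta2_sub_half] at h
  rw [h, map_sub, map_div₀, map_one, map_ofNat, theta2_sub_half]

lemma differentiable_theta1 {τ : ℂ} (him : 0 < τ.im) : Differentiable ℂ (theta1 τ) := by
  have : theta1 τ = fun u => -(cexp (π * I * (τ / 4 + (u + 1 / 2))) *
      jacobiTheta₂ (u + 1 / 2 + τ / 2) τ) := by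
    funext u
    rw [← theta2_eq _ _ him, theta2_add_half, neg_neg]
  rw [this]
  intro u
  have h : DifferentiableAt ℂ (fun u : ℂ => jacobiTheta₂ (u + 1 / 2 + τ / 2) τ) u :=
    (differentiableAt_jacobiTheta₂_fst (u + 1 / 2 + τ / 2) him).comp u
      (f := fun u : ℂ => u + 1 / 2 + τ / 2) (by fun_prop)
  fun_prop

/-! ### Identities at u ± 1/4 and relations between theta constants -/

/-- This is the numerator of r(u) - r(v); its factorization shows when two values of r coincide, and
its derivative on the diagonal gives the Wronskian behind ℰ. The companion `theta1_prod_add` treats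
r(u) + r(v). -/
lemma theta1_prod_sub {τ : ℂ} (him : 0 < τ.im) (u v : ℂ) :
    theta1 τ (u + 1 / 4) * theta1 τ (v - 1 / 4) - theta1 τ (u - 1 / 4) * theta1 τ (v + 1 / 4) =
      -2 * (theta3 (2 * τ) (u + v) * theta1 (2 * τ) (u - v)) := by
  rw [theta1_mul_theta1 _ _ _ him, theta1_mul_theta1 _ _ _ him,
    show u + 1 / 4 + (v - 1 / 4) = u + v by ring,
    show u - 1 / 4 + (v + 1 / 4) = u + v by ring,
    show u + 1 / 4 - (v - 1 / 4) = u - v + 1 / 2 by ring,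
    show u - 1 / 4 - (v + 1 / 4) = u - v - 1 / 2 by ring, theta2_add_half, theta2_sub_half,
    theta3_add_half, theta3_sub_half]
  ring

lemma theta1_prod_add {τ : ℂ} (him : 0 < τ.im) (u v : ℂ) :
    theta1 τ (u + 1 / 4) * theta1 τ (v - 1 / 4) + theta1 τ (u - 1 / 4) * theta1 τ (v + 1 / 4) =
      -2 * (theta2 (2 * τ) (u + v) * theta4 (2 * τ) (u - v)) := by
  rw [theta1_mul_theta1 _ _ _ him, theta1_mul_theta1 _ _ _ him,
    show u + 1 / 4 + (v - 1 / 4) = u + v by ring,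
    show u - 1 / 4 + (v + 1 / 4) = u + v by ring,
    show u + 1 / 4 - (v - 1 / 4) = u - v + 1 / 2 by ring,
    show u - 1 / 4 - (v + 1 / 4) = u - v - 1 / 2 by ring, theta2_add_half, theta2_sub_half,
    theta3_add_half, theta3_sub_half]
  ring

lemma theta1_quarter_mul {τ : ℂ} (him : 0 < τ.im) (u : ℂ) :
    theta1 τ (u + 1 / 4) * theta1 τ (u - 1 / 4) =
      -(theta2 (2 * τ) (2 * u) * theta4 (2 * τ) 0) := by
  have h := theta1_prod_add him u u
  rw [sub_self, ← two_mul u] at h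
  linear_combination h / 2

lemma theta1_quarter_sq {τ : ℂ} (him : 0 < τ.im) (u : ℂ) :
    theta1 τ (u + 1 / 4) ^ 2 = theta4 (2 * τ) (2 * u) * theta2 (2 * τ) 0 +
        theta1 (2 * τ) (2 * u) * theta3 (2 * τ) 0 ∧
    theta1 τ (u - 1 / 4) ^ 2 = theta4 (2 * τ) (2 * u) * theta2 (2 * τ) 0 -
        theta1 (2 * τ) (2 * u) * theta3 (2 * τ) 0 := by
  constructor <;> rw [sq, theta1_mul_theta1 _ _ _ him, sub_self]
  · rw [show u + 1 / 4 + (u + 1 / 4) = 2 * u + 1 / 2 by ring, theta3_add_half, theta2_add_half]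
    ring
  · rw [show u - 1 / 4 + (u - 1 / 4) = 2 * u - 1 / 2 by ring, theta3_sub_half, theta2_sub_half]

lemma theta3_quarter_mul {τ : ℂ} (him : 0 < τ.im) (u : ℂ) :
    theta3 τ (u + 1 / 4) * theta3 τ (u - 1 / 4) =
      theta3 (2 * τ) (2 * u) * theta4 (2 * τ) 0 := by
  rw [theta3_mul_theta3 _ _ _ him, show u + 1 / 4 + (u - 1 / 4) = 2 * u by ring,
    show u + 1 / 4 - (u - 1 / 4) = 0 + 1 / 2 by ring, theta3_add_half, theta2_add_half,
    theta1_zero]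
  ring

lemma theta3_quarter_sq {τ : ℂ} (him : 0 < τ.im) (u : ℂ) :
    theta3 τ (u + 1 / 4) ^ 2 = theta4 (2 * τ) (2 * u) * theta3 (2 * τ) 0 -
        theta1 (2 * τ) (2 * u) * theta2 (2 * τ) 0 ∧
    theta3 τ (u - 1 / 4) ^ 2 = theta4 (2 * τ) (2 * u) * theta3 (2 * τ) 0 +
        theta1 (2 * τ) (2 * u) * theta2 (2 * τ) 0 := by
  constructor <;> rw [sq, theta3_mul_theta3 _ _ _ him, sub_self]
  · rw [show u + 1 / 4 + (u + 1 / 4) = 2 * u + 1 / 2 by ring, theta3_add_half, theta2_add_half]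
    ring
  · rw [show u - 1 / 4 + (u - 1 / 4) = 2 * u - 1 / 2 by ring, theta3_sub_half, theta2_sub_half]

lemma theta3_zero_sq {τ : ℂ} (him : 0 < τ.im) :
    theta3 τ 0 ^ 2 = theta3 (2 * τ) 0 ^ 2 + theta2 (2 * τ) 0 ^ 2 := by
  rw [sq, theta3_mul_theta3 _ _ _ him]
  simp only [add_zero, sub_zero]
  ring

lemma theta4_zero_sq {τ : ℂ} (him : 0 < τ.im) :
    theta4 τ 0 ^ 2 = theta3 (2 * τ) 0 ^ 2 - theta2 (2 * τ) 0 ^ 2 := by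
  rw [sq, ← theta3_add_half, theta3_mul_theta3 _ _ _ him,
    show (0 : ℂ) + 1 / 2 + (0 + 1 / 2) = 0 + 1 / 2 + 1 / 2 by ring, sub_self, theta3_add_half,
    theta4_add_half, theta2_add_half, theta1_add_half]
  ring

lemma theta4_zero_mul_theta3_zero {τ : ℂ} (him : 0 < τ.im) :
    theta4 τ 0 * theta3 τ 0 = theta4 (2 * τ) 0 ^ 2 := by
  rw [theta4_mul_theta3 him, mul_zero, sq]

lemma theta2_zero_sq {τ : ℂ} (him : 0 < τ.im) :
    theta2 τ 0 ^ 2 = 2 * (theta2 (2 * τ) 0 * theta3 (2 * τ) 0) := by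
  rw [sq, theta2_mul_theta2 _ _ _ him]
  simp only [add_zero, sub_zero]
  ring

lemma theta1_mul_theta2 {τ : ℂ} (him : 0 < τ.im) (z : ℂ) :
    theta1 τ z * theta2 τ z = theta4 (2 * τ) 0 * theta1 (2 * τ) (2 * z) := by
  rw [← theta1_add_half, theta1_mul_theta1 _ _ _ him,
    show z + (z + 1 / 2) = 2 * z + 1 / 2 by ring, show z - (z + 1 / 2) = 0 - 1 / 2 by ring,
    theta2_sub_half, theta1_zero, theta2_add_half, theta3_sub_half]
  ring

lemma theta_zero_quartic {τ : ℂ} (him : 0 < τ.im) :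
    theta3 (2 * τ) 0 ^ 4 - theta2 (2 * τ) 0 ^ 4 = theta4 (2 * τ) 0 ^ 4 := by
  have h1 := theta3_zero_sq him
  have h2 := theta4_zero_sq him
  have h3 := theta4_zero_mul_theta3_zero him
  calc _ = (theta3 (2 * τ) 0 ^ 2 + theta2 (2 * τ) 0 ^ 2) *
        (theta3 (2 * τ) 0 ^ 2 - theta2 (2 * τ) 0 ^ 2) := by ring
    _ = _ := by rw [← h1, ← h2, ← mul_pow, mul_comm, h3]; ring

/-- The quadratic relation between `θ₂`, `θ₃` and `θ₄`. -/
lemma theta_sq_relation {τ : ℂ} (him : 0 < τ.im) (h0 : theta4 (2 * τ) 0 ≠ 0) (u : ℂ) :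
    theta3 (2 * τ) 0 ^ 2 * theta3 (2 * τ) (2 * u) ^ 2 =
      theta4 (2 * τ) (2 * u) ^ 2 * theta4 (2 * τ) 0 ^ 2 +
        theta2 (2 * τ) 0 ^ 2 * theta2 (2 * τ) (2 * u) ^ 2 := by
  obtain ⟨a1, a2⟩ := theta1_quarter_sq him u
  obtain ⟨b1, b2⟩ := theta3_quarter_sq him u
  have a3 := congrArg (· ^ 2) (theta1_quarter_mul him u)
  have b3 := congrArg (· ^ 2) (theta3_quarter_mul him u)
  simp only [mul_pow, neg_sq] at a3 b3
  rw [a1, a2] at a3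
  rw [b1, b2] at b3
  have q := theta_zero_quartic him
  -- The squared products at u ± 1/4 also equal products of squares. Their combination below
  -- eliminates θ₁(2u)² at modulus 2τ.
  refine mul_right_cancel₀ (pow_ne_zero 2 h0) ?_
  linear_combination theta4 (2 * τ) (2 * u) ^ 2 * q - theta3 (2 * τ) 0 ^ 2 * b3 +
    theta2 (2 * τ) 0 ^ 2 * a3

/-! ### Derivatives of theta functions -/

lemma differentiable_theta2 {τ : ℂ} (him : 0 < τ.im) : Differentiable ℂ (theta2 τ) := by
  have : theta2 τ = fun u => theta1 τ (u + 1 / 2) := funext fun u => (theta1_add_half τ u).symm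
  rw [this]
  exact (differentiable_theta1 him).comp (by fun_prop)

lemma differentiable_theta3 {τ : ℂ} (him : 0 < τ.im) : Differentiable ℂ (theta3 τ) := by
  have : theta3 τ = fun u => jacobiTheta₂ u τ := funext fun u => theta3_eq τ u him
  rw [this]
  exact fun u => differentiableAt_jacobiTheta₂_fst u him

/-- Differentiate `theta1_prod_sub` in u at u = v; only the derivative of the factor vanishing there
survives. -/
lemma theta1_wronskian {τ : ℂ} (him : 0 < τ.im) (v : ℂ) :
    deriv (theta1 τ) (v + 1 / 4) * theta1 τ (v - 1 / 4) -
      deriv (theta1 τ) (v - 1 / 4) * theta1 τ (v + 1 / 4) =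
      -2 * (theta3 (2 * τ) (2 * v) * deriv (theta1 (2 * τ)) 0) := by
  have d1 := differentiable_theta1 him
  have him2 := two_mul_im_pos him
  have l1 : HasDerivAt (fun u => theta1 τ (u + 1 / 4)) (deriv (theta1 τ) (v + 1 / 4)) v := by
    simpa using (d1 (v + 1 / 4)).hasDerivAt.comp_add_const v (1 / 4)
  have l2 : HasDerivAt (fun u => theta1 τ (u - 1 / 4)) (deriv (theta1 τ) (v - 1 / 4)) v := by
    simpa using (d1 (v - 1 / 4)).hasDerivAt.comp_sub_const v (1 / 4)
  have r1 : HasDerivAt (fun u => theta3 (2 * τ) (u + v)) (deriv (theta3 (2 * τ)) (v + v)) v := by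
    simpa using (differentiable_theta3 him2 (v + v)).hasDerivAt.comp_add_const v v
  have r2 : HasDerivAt (fun u => theta1 (2 * τ) (u - v)) (deriv (theta1 (2 * τ)) (v - v)) v := by
    simpa using (differentiable_theta1 him2 (v - v)).hasDerivAt.comp_sub_const v v
  have L := (l1.mul_const (theta1 τ (v - 1 / 4))).sub (l2.mul_const (theta1 τ (v + 1 / 4)))
  have Rr := (r1.mul r2).const_mul (-2)
  have e := funext fun u => theta1_prod_sub him u v
  have := L.unique (e ▸ Rr : HasDerivAt _ _ v)
  rw [this, sub_self, theta1_zero, ← two_mul v]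
  ring

lemma deriv_theta1_zero_mul {τ : ℂ} (him : 0 < τ.im) :
    deriv (theta1 τ) 0 * theta2 τ 0 = 2 * theta4 (2 * τ) 0 * deriv (theta1 (2 * τ)) 0 := by
  have him2 := two_mul_im_pos him
  have L := (differentiable_theta1 him 0).hasDerivAt.mul (differentiable_theta2 him 0).hasDerivAt
  have h2 : HasDerivAt (fun z : ℂ => 2 * z) (2 * 1) 0 := (hasDerivAt_id (0 : ℂ)).const_mul 2
  have d0 : HasDerivAt (theta1 (2 * τ)) (deriv (theta1 (2 * τ)) 0) (2 * (0 : ℂ)) := by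
    rw [mul_zero]; exact (differentiable_theta1 him2 0).hasDerivAt
  have Rr := (d0.comp 0 h2).const_mul (theta4 (2 * τ) 0)
  have e : (theta1 τ * theta2 τ) =
      fun z => theta4 (2 * τ) 0 * (theta1 (2 * τ) ∘ fun z => 2 * z) z :=
    funext fun z => theta1_mul_theta2 him z
  rw [e] at L
  have := L.unique Rr
  rw [theta1_zero] at this
  linear_combination this

/-! ### Reflection symmetry and location of the Bethe roots -/

lemma r_half_sub (τ u : ℂ) : r τ (1 / 2 - u) = -r τ u := by
  rw [r, r, show 1 / 2 - u + 1 / 4 = -(u - 1 / 4) + 1 / 2 by ring,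
    show 1 / 2 - u - 1 / 4 = -(u + 1 / 4) + 1 / 2 by ring, theta1_add_half, theta1_add_half,
    theta2_neg, theta2_neg, show u - 1 / 4 = (u + 1 / 4) - 1 / 2 by ring, theta2_sub_half,
    theta1_sub_half, div_neg, neg_neg]

lemma R_half_sub (τ u : ℂ) : R τ (1 / 2 - u) = R τ u := by
  rw [R, R, show 1 / 2 - u + 1 / 4 = -(u - 1 / 4) + 1 / 2 by ring,
    show 1 / 2 - u - 1 / 4 = -(u + 1 / 4) + 1 / 2 by ring, theta3_add_half, theta3_add_half,
    theta4_neg, theta4_neg, show u - 1 / 4 = (u + 1 / 4) - 1 / 2 by ring, theta4_sub_half,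
    theta3_sub_half]

lemma r_half_period {τ : ℂ} (him : 0 < τ.im) (h : theta1 τ (τ / 2 - 1 / 4) ≠ 0) :
    r τ (τ / 2) = -I := by
  have e : ∀ z : ℂ, theta1 τ z =
      -(cexp (π * I * (τ / 4 + (z + 1 / 2))) * jacobiTheta₂ (z + 1 / 2 + τ / 2) τ) := fun z => by
    rw [← theta2_eq _ _ him, theta2_add_half, neg_neg]
  have a : theta1 τ (τ / 2 + 1 / 4) = -I * theta1 τ (τ / 2 - 1 / 4) := by
    rw [e, e, show τ / 2 + 1 / 4 + 1 / 2 + τ / 2 = -(1 / 4) + 1 + τ by ring,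
      show τ / 2 - 1 / 4 + 1 / 2 + τ / 2 = 1 / 4 + τ by ring, jacobiTheta₂_add_left',
      jacobiTheta₂_add_left', jacobiTheta₂_add_left, jacobiTheta₂_neg_left, ← mul_assoc,
      ← mul_assoc, ← Complex.exp_add, ← Complex.exp_add,
      show π * I * (τ / 4 + (τ / 2 + 1 / 4 + 1 / 2)) + -π * I * (τ + 2 * (-(1 / 4) + 1)) =
        -π / 2 * I + (π * I * (τ / 4 + (τ / 2 - 1 / 4 + 1 / 2)) + -π * I * (τ + 2 * (1 / 4)))
        by ring, Complex.exp_add, Complex.exp_mul_I, neg_div, Complex.cos_neg, Complex.sin_neg,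
      Complex.cos_pi_div_two, Complex.sin_pi_div_two]
    ring
  rw [r, a, mul_div_cancel_right₀ _ h]

/-- `u` is `i y` (with `σ = -1`) or `1/2 - i y` (with `σ = 1`), where `-Im τ / 2 < y ≤ Im τ / 2`. -/
def IsAxisPoint (τ u : ℂ) (σ y : ℝ) : Prop :=
  -(τ.im / 2) < y ∧ y ≤ τ.im / 2 ∧ ((σ = -1 ∧ u = y * I) ∨ (σ = 1 ∧ u = 1 / 2 - y * I))

lemma norm_eq_one_of_pow_eq {z : ℂ} {N k : ℕ} (hN : 0 < N) (h : z ^ N = (-1) ^ k) : ‖z‖ = 1 := by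
  have := congrArg norm h
  rw [norm_pow, norm_pow, norm_neg, norm_one, one_pow] at this
  exact (pow_eq_one_iff_of_nonneg (norm_nonneg _) hN.ne').1 this

/-- Since θ₁ commutes with conjugation, |r(u)| = 1 is an identity between products of θ₁ at u and
its conjugate. The product formula turns it into θ₁(2 Re u) θ₃(2i Im u) = 0 at modulus 2τ. The
second factor is positive, and the first vanishes in the root domain only for Re u = 0 or Re u =
1/2. -/
lemma exists_isAxisPoint {τ u : ℂ} (hre : τ.re = 0) (him : 0 < τ.im) (hu : u ∈ rootDomain τ)
    (hr : ‖r τ u‖ = 1) : ∃ σ y, IsAxisPoint τ u σ y := by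
  have him2 := two_mul_im_pos him
  have hre2 := two_mul_re hre
  have hden : theta1 τ (u - 1 / 4) ≠ 0 := by
    intro h
    rw [r, h, div_zero, norm_zero] at hr
    exact zero_ne_one hr
  have hn : ‖theta1 τ (u + 1 / 4)‖ = ‖theta1 τ (u - 1 / 4)‖ := by
    rwa [r, norm_div, div_eq_one_iff_eq (norm_ne_zero_iff.2 hden)] at hr
  have hm : theta1 τ (u + 1 / 4) * theta1 τ (conj u + 1 / 4) =
      theta1 τ (u - 1 / 4) * theta1 τ (conj u - 1 / 4) := by
    have e1 : conj u + 1 / 4 = conj (u + 1 / 4) := by simp [map_ofNat]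
    have e2 : conj u - 1 / 4 = conj (u - 1 / 4) := by simp [map_ofNat]
    rw [e1, e2, ← theta1_conj hre him, ← theta1_conj hre him, mul_conj, mul_conj,
      normSq_eq_norm_sq, normSq_eq_norm_sq, hn]
  have hz : theta1 (2 * τ) ((2 * u.re : ℝ) : ℂ) = 0 := by
    obtain ⟨c, hc, h3⟩ := theta3_imaginary_pos hre2 him2 (2 * u.im)
    rw [theta1_mul_theta1 _ _ _ him, theta1_mul_theta1 _ _ _ him,
      show u + 1 / 4 + (conj u + 1 / 4) = ((2 * u.re : ℝ) : ℂ) + 1 / 2 by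
        rw [← add_conj]; ring,
      show u - 1 / 4 + (conj u - 1 / 4) = ((2 * u.re : ℝ) : ℂ) - 1 / 2 by
        rw [← add_conj]; ring,
      show u + 1 / 4 - (conj u + 1 / 4) = ((2 * u.im : ℝ) : ℂ) * I by
        rw [← sub_conj]; ring,
      show u - 1 / 4 - (conj u - 1 / 4) = ((2 * u.im : ℝ) : ℂ) * I by
        rw [← sub_conj]; ring,
      theta3_add_half, theta3_sub_half, theta2_add_half, theta2_sub_half, h3] at hm
    have : (c : ℂ) ≠ 0 := by exact_mod_cast hc.ne'
    have : theta1 (2 * τ) ((2 * u.re : ℝ) : ℂ) * c = 0 := by linear_combination hm / 2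
    exact (mul_eq_zero.1 this).resolve_right ‹_›
  have hx : 2 * u.re = 0 ∨ 1 ≤ |2 * u.re| := by
    by_contra! h
    exact theta1_real_ne_zero hre2 him2 h.1 h.2 hz
  rcases hu with ⟨h1, h2, h3, h4⟩ | ⟨h1, h2, h3, h4⟩
  · refine ⟨-1, u.im, h3, h4, Or.inl ⟨rfl, ?_⟩⟩
    have : u.re = 0 := by
      rcases hx with h | h
      · linarith
      · rw [abs_of_nonpos (by linarith)] at h; linarith
    apply Complex.ext <;> simp [this]
  -- The two rectangles omit opposite horizontal edges, so after this change of sign y runs over the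
  -- same half-open interval on both lines.
  · refine ⟨1, -u.im, by linarith, by linarith, Or.inr ⟨rfl, ?_⟩⟩
    have : u.re = 1 / 2 := by
      rcases hx with h | h
      · linarith
      · rw [abs_of_nonneg (by linarith)] at h; linarith
    apply Complex.ext <;> simp [this]

lemma IsAxisPoint.sign {τ u : ℂ} {σ y : ℝ} (h : IsAxisPoint τ u σ y) : σ = 1 ∨ σ = -1 := by
  rcases h.2.2 with h | h <;> simp [h.1]

lemma IsAxisPoint.abs_le {τ u : ℂ} {σ y : ℝ} (h : IsAxisPoint τ u σ y) : |y| ≤ τ.im / 2 :=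
  _root_.abs_le.2 ⟨h.1.le, h.2.1⟩

lemma IsAxisPoint.theta2_eq {τ u : ℂ} {σ y : ℝ} (h : IsAxisPoint τ u σ y) (ω : ℂ) :
    theta2 ω (2 * u) = -σ * theta2 ω ((2 * y : ℝ) * I) := by
  rcases h.2.2 with ⟨rfl, rfl⟩ | ⟨rfl, rfl⟩
  · push_cast; ring_nf
  · rw [show 2 * (1 / 2 - y * I) = -((2 * y : ℝ) * I) + 1 / 2 + 1 / 2 by push_cast; ring,
      theta2_add_half, theta1_add_half, theta2_neg]
    push_cast; ring

lemma IsAxisPoint.theta3_eq {τ u : ℂ} {σ y : ℝ} (h : IsAxisPoint τ u σ y) (ω : ℂ) :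
    theta3 ω (2 * u) = theta3 ω ((2 * y : ℝ) * I) := by
  rcases h.2.2 with ⟨rfl, rfl⟩ | ⟨rfl, rfl⟩
  · push_cast; ring_nf
  · rw [show 2 * (1 / 2 - y * I) = -((2 * y : ℝ) * I) + 1 / 2 + 1 / 2 by push_cast; ring,
      theta3_add_half, theta4_add_half, theta3_neg]

lemma IsAxisPoint.theta4_eq {τ u : ℂ} {σ y : ℝ} (h : IsAxisPoint τ u σ y) (ω : ℂ) :
    theta4 ω (2 * u) = theta4 ω ((2 * y : ℝ) * I) := by
  rcases h.2.2 with ⟨rfl, rfl⟩ | ⟨rfl, rfl⟩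
  · push_cast; ring_nf
  · rw [show 2 * (1 / 2 - y * I) = -((2 * y : ℝ) * I) + 1 / 2 + 1 / 2 by push_cast; ring,
      theta4_add_half, theta3_add_half, theta4_neg]

lemma theta_constants_pos {τ : ℂ} (hre : τ.re = 0) (him : 0 < τ.im) :
    ∃ b c d : ℝ, 0 < b ∧ 0 < c ∧ 0 < d ∧ theta2 τ 0 = b ∧ theta3 τ 0 = c ∧ theta4 τ 0 = d := by
  obtain ⟨b, hb, h2⟩ := theta2_imaginary_pos hre him 0
  obtain ⟨c, hc, h3⟩ := theta3_imaginary_pos hre him 0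
  obtain ⟨d, hd, h4⟩ := theta4_imaginary_pos hre (y := 0) (by simpa using him)
  rw [ofReal_zero, zero_mul] at h2 h3 h4
  exact ⟨b, c, d, hb, hc, hd, h2, h3, h4⟩

lemma IsAxisPoint.theta1_ne_zero {τ u : ℂ} {σ y : ℝ} (hre : τ.re = 0) (him : 0 < τ.im)
    (h : IsAxisPoint τ u σ y) :
    theta1 τ (u + 1 / 4) ≠ 0 ∧ theta1 τ (u - 1 / 4) ≠ 0 := by
  have := theta1_quarter_mul him u
  obtain ⟨p, hp, h2⟩ := theta2_imaginary_pos (two_mul_re hre) (two_mul_im_pos him) (2 * y)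
  obtain ⟨b, c, d, hb, hc, hd, -, -, h4⟩ :=
    theta_constants_pos (two_mul_re hre) (two_mul_im_pos him)
  rw [h.theta2_eq, h2, h4] at this
  rw [← mul_ne_zero_iff, this]
  have hσ : σ ≠ 0 := by rcases h.sign with h | h <;> simp [h]
  norm_cast
  exact neg_ne_zero.2 (mul_ne_zero (mul_ne_zero (neg_ne_zero.2 hσ) hp.ne') hd.ne')

lemma IsAxisPoint.theta3_ne_zero {τ u : ℂ} {σ y : ℝ} (hre : τ.re = 0) (him : 0 < τ.im)
    (h : IsAxisPoint τ u σ y) :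
    theta3 τ (u + 1 / 4) ≠ 0 ∧ theta3 τ (u - 1 / 4) ≠ 0 := by
  have := theta3_quarter_mul him u
  obtain ⟨p, hp, h3⟩ := theta3_imaginary_pos (two_mul_re hre) (two_mul_im_pos him) (2 * y)
  obtain ⟨b, c, d, hb, hc, hd, -, -, h4⟩ :=
    theta_constants_pos (two_mul_re hre) (two_mul_im_pos him)
  rw [h.theta3_eq, h3, h4] at this
  rw [← mul_ne_zero_iff, this]
  norm_cast
  exact mul_ne_zero hp.ne' hd.ne'

lemma IsAxisPoint.isAxisPoint_half_sub {τ u : ℂ} {σ y : ℝ} (h : IsAxisPoint τ u σ y) :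
    IsAxisPoint τ (1 / 2 - u) (-σ) y := by
  refine ⟨h.1, h.2.1, ?_⟩
  rcases h.2.2 with ⟨rfl, rfl⟩ | ⟨rfl, rfl⟩
  · right; simp
  · left; simp

/-- The reflection u ↦ 1/2 - u reduces to the imaginary axis. There r(u) = r(v) forces θ₁(u - v)
θ₃(u + v) = 0 at modulus 2τ, hence u = v because |y - y'| < Im τ. The case r(u) = -r(v) would make
the positive number θ₂(u + v) θ₄(u - v) vanish. -/
lemma IsAxisPoint.eq_of_sign_eq {τ u v : ℂ} {σ y y' : ℝ} (hre : τ.re = 0) (him : 0 < τ.im)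
    (hu : IsAxisPoint τ u σ y) (hv : IsAxisPoint τ v σ y') (h : r τ u ^ 2 = r τ v ^ 2) : u = v := by
  wlog hσ : σ = -1 generalizing u v σ
  · have := this hu.isAxisPoint_half_sub hv.isAxisPoint_half_sub
      (by rw [r_half_sub, r_half_sub, neg_sq, neg_sq, h])
      (by rw [hu.sign.resolve_right hσ])
    linear_combination -this
  subst hσ
  have eu : u = y * I := by rcases hu.2.2 with h | h <;> [exact h.2; norm_num at h]
  have ev : v = y' * I := by rcases hv.2.2 with h | h <;> [exact h.2; norm_num at h]
  have hre2 := two_mul_re hre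
  have him2 := two_mul_im_pos him
  have nu := (hu.theta1_ne_zero hre him).2
  have nv := (hv.theta1_ne_zero hre him).2
  have hlt : |y - y'| < τ.im := abs_lt.2 ⟨by linarith [hu.1, hv.2.1], by linarith [hu.2.1, hv.1]⟩
  have im2 : (2 * τ).im = 2 * τ.im := by simp
  have es : u + v = ((y + y' : ℝ) : ℂ) * I := by rw [eu, ev]; push_cast; ring
  have ed : u - v = ((y - y' : ℝ) : ℂ) * I := by rw [eu, ev]; push_cast; ring
  rcases sq_eq_sq_iff_eq_or_eq_neg.1 h with h | h
  · rw [r, r, div_eq_div_iff nu nv] at h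
    have p := theta1_prod_sub him u v
    obtain ⟨c, hc, h3⟩ := theta3_imaginary_pos hre2 him2 (y + y')
    rw [es, ed, h3, h, mul_comm (theta1 τ (v + 1 / 4)), sub_self] at p
    by_contra hne
    have hy : y - y' ≠ 0 := by
      intro h0
      rw [h0, ofReal_zero, zero_mul] at ed
      exact hne (sub_eq_zero.1 ed)
    have q := theta1_imaginary_ne_zero hre2 him2 hy (by rw [im2]; linarith)
    have hc' : (c : ℂ) ≠ 0 := by exact_mod_cast hc.ne'
    exact mul_ne_zero (by norm_num) (mul_ne_zero hc' q) p.symm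
  · rw [r, r, ← neg_div, div_eq_div_iff nu nv] at h
    have p := theta1_prod_add him u v
    obtain ⟨c, hc, h2⟩ := theta2_imaginary_pos hre2 him2 (y + y')
    obtain ⟨e, he, h4⟩ := theta4_imaginary_pos hre2 (y := y - y') (by rw [im2]; linarith)
    rw [es, ed, h2, h4, h, neg_mul, mul_comm (theta1 τ (v + 1 / 4)), neg_add_cancel] at p
    norm_cast at p
    exact absurd p.symm (mul_ne_zero (by norm_num) (mul_ne_zero hc.ne' he.ne'))

/-- On the two lines carrying the Bethe roots, `r²` takes the same value exactly at `u` and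
`1/2 - u`. -/
lemma IsAxisPoint.eq_or_eq_half_sub {τ u v : ℂ} {σ σ' y y' : ℝ} (hre : τ.re = 0) (him : 0 < τ.im)
    (hu : IsAxisPoint τ u σ y) (hv : IsAxisPoint τ v σ' y') (h : r τ u ^ 2 = r τ v ^ 2) :
    v = u ∨ v = 1 / 2 - u := by
  by_cases hσ : σ' = σ
  · subst hσ
    exact Or.inl (hu.eq_of_sign_eq hre him hv h).symm
  · right
    have hv' := hv.isAxisPoint_half_sub
    have : -σ' = σ := by
      rcases hu.sign with h | h <;> rcases hv.sign with h' | h' <;> simp_all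
    rw [this] at hv'
    have := hu.eq_of_sign_eq hre him hv' (by rw [r_half_sub, neg_sq, h])
    linear_combination this

/-- For imaginary u the points u + 1/4 and u - 1/4 are exchanged by conjugation followed by
negation, and θ₃ is even, so numerator and denominator of R are conjugate. The other line follows by
reflection. -/
lemma IsAxisPoint.norm_R {τ u : ℂ} {σ y : ℝ} (hre : τ.re = 0) (him : 0 < τ.im)
    (h : IsAxisPoint τ u σ y) : ‖R τ u‖ = 1 := by
  wlog hσ : σ = -1 generalizing u σ
  · have := this h.isAxisPoint_half_sub (by rw [h.sign.resolve_right hσ])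
    rwa [R_half_sub] at this
  subst hσ
  have eu : u = y * I := by rcases h.2.2 with h | h <;> [exact h.2; norm_num at h]
  have hc : conj (theta3 τ (u + 1 / 4)) = theta3 τ (u - 1 / 4) := by
    rw [theta3_conj hre him, ← theta3_neg]
    congr 1
    rw [eu]
    simp only [map_add, map_mul, conj_ofReal, conj_I, map_div₀, map_one, map_ofNat]
    ring
  rw [R, norm_div, ← hc, RCLike.norm_conj, div_self]
  exact norm_ne_zero_iff.2 (h.theta3_ne_zero hre him).1

/-! ### Explicit values of r, R, the energy and the couplings -/

lemma r_zero {τ : ℂ} (h : theta1 τ (-(1 / 4)) ≠ 0) : r τ 0 = -1 := by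
  rw [r, zero_add, zero_sub]
  rw [theta1_neg] at h ⊢
  rw [div_neg, div_self (neg_ne_zero.1 h)]

/-- If θ₁'(0) vanished at τ it would vanish at 2τ by `deriv_theta1_zero_mul`, so the Wronskian of
`theta1_wronskian` would be zero and r constant along the imaginary axis. But r(0) = -1 and r(τ/2) =
-i. -/
lemma deriv_theta1_zero_ne_zero {τ : ℂ} (hre : τ.re = 0) (him : 0 < τ.im) :
    deriv (theta1 τ) 0 ≠ 0 := by
  have him2 := two_mul_im_pos him
  obtain ⟨b, c, d, hb, hc, hd, h2, -, -⟩ := theta_constants_pos hre him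
  intro h0
  have hm := deriv_theta1_zero_mul him
  obtain ⟨b', c', d', hb', hc', hd', h2', h3', h4'⟩ := theta_constants_pos (two_mul_re hre) him2
  rw [h0, zero_mul, h4'] at hm
  have hd0 : deriv (theta1 (2 * τ)) 0 = 0 := by
    have : (d' : ℂ) ≠ 0 := by exact_mod_cast hd'.ne'
    have := mul_ne_zero (two_ne_zero (α := ℂ)) this
    exact (mul_eq_zero.1 hm.symm).resolve_left this
  have hne : ∀ x : ℝ, theta1 τ (x * I - 1 / 4) ≠ 0 := by
    intro x h
    have p := theta1_quarter_mul him (x * I)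
    obtain ⟨e, he, hq⟩ := theta2_imaginary_pos (two_mul_re hre) him2 (2 * x)
    rw [ofReal_mul, ofReal_ofNat, mul_assoc] at hq
    rw [h, mul_zero, hq, h4'] at p
    norm_cast at p
    exact absurd p.symm (neg_ne_zero.2 (mul_ne_zero he.ne' hd'.ne'))
  have hder : ∀ x : ℝ, HasDerivAt (fun x : ℝ => r τ (x * I)) 0 x := by
    intro x
    have d1 := differentiable_theta1 him
    have l1 : HasDerivAt (fun u => theta1 τ (u + 1 / 4)) (deriv (theta1 τ) (x * I + 1 / 4))
        (x * I) := by
      simpa using (d1 (x * I + 1 / 4)).hasDerivAt.comp_add_const (x * I) (1 / 4)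
    have l2 : HasDerivAt (fun u => theta1 τ (u - 1 / 4)) (deriv (theta1 τ) (x * I - 1 / 4))
        (x * I) := by
      simpa using (d1 (x * I - 1 / 4)).hasDerivAt.comp_sub_const (x * I) (1 / 4)
    have l := l1.div l2 (hne x)
    have w := theta1_wronskian him (x * I)
    rw [hd0, mul_zero, mul_zero] at w
    have l3 : HasDerivAt (r τ) 0 (x * I) := by
      have e : (theta1 τ (x * I + 1 / 4) * deriv (theta1 τ) (x * I - 1 / 4)) =
        deriv (theta1 τ) (x * I + 1 / 4) * theta1 τ (x * I - 1 / 4) := by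
          linear_combination -w
      rw [e, sub_self, zero_div] at l
      exact l
    have l4 : HasDerivAt (fun x : ℝ => (x : ℂ) * I) I x := by
      simpa using (HasDerivAt.ofReal_comp (hasDerivAt_id x)).mul_const I
    have l5 := l3.comp x l4
    rw [zero_mul] at l5
    exact l5
  have hconst := is_const_of_deriv_eq_zero (fun x => (hder x).differentiableAt)
    (fun x => (hder x).deriv) 0 (τ.im / 2)
  have e : ((τ.im / 2 : ℝ) : ℂ) * I = τ / 2 := by
    conv_rhs => rw [eq_im_mul_I hre]
    push_cast; ring
  have q := hne (τ.im / 2)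
  have q0 := hne 0
  rw [e] at q
  rw [ofReal_zero, zero_mul, zero_sub] at q0
  simp only [e, ofReal_zero, zero_mul, r_half_period him q, r_zero q0] at hconst
  have := congrArg re hconst
  norm_num at this

lemma div_add_inv_div {K : Type*} [Field K] {a b : K} (ha : a ≠ 0) (hb : b ≠ 0) :
    a / b + (a / b)⁻¹ = (a ^ 2 + b ^ 2) / (a * b) := by field_simp

lemma div_sub_inv_div {K : Type*} [Field K] {a b : K} (ha : a ≠ 0) (hb : b ≠ 0) :
    a / b - (a / b)⁻¹ = (a ^ 2 - b ^ 2) / (a * b) := by field_simp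

/-- The difference of logarithmic derivatives is a Wronskian over a product, both known at modulus
2τ. The remaining constant θ₁'(0 | 2τ) is traded for θ₁'(0 | τ) and cancels the prefactor. -/
lemma energy_eq {τ u : ℂ} (hre : τ.re = 0) (him : 0 < τ.im)
    (hp : theta1 τ (u + 1 / 4) ≠ 0) (hm : theta1 τ (u - 1 / 4) ≠ 0) :
    energy τ u = -4 * (theta2 (2 * τ) 0 * theta3 (2 * τ) 0 * theta3 (2 * τ) (2 * u)) /
      (theta2 (2 * τ) (2 * u) * theta4 (2 * τ) 0 ^ 2) := by
  have w := theta1_wronskian him u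
  have d0 := deriv_theta1_zero_ne_zero hre him
  have m0 := deriv_theta1_zero_mul him
  have q := theta1_quarter_mul him u
  have s := theta2_zero_sq him
  obtain ⟨b, c, d, hb, hc, hd, -, -, h4⟩ :=
    theta_constants_pos (two_mul_re hre) (two_mul_im_pos him)
  have h40 : theta4 (2 * τ) 0 ≠ 0 := by rw [h4]; exact_mod_cast hd.ne'
  have h20 : theta2 (2 * τ) (2 * u) ≠ 0 := by
    intro h
    rw [h, zero_mul, neg_zero] at q
    exact mul_ne_zero hp hm q
  have e : deriv (theta1 τ) (u - 1 / 4) / theta1 τ (u - 1 / 4) -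
      deriv (theta1 τ) (u + 1 / 4) / theta1 τ (u + 1 / 4) =
      -(2 * theta3 (2 * τ) (2 * u) * deriv (theta1 (2 * τ)) 0) /
        (theta2 (2 * τ) (2 * u) * theta4 (2 * τ) 0) := by
    rw [div_sub_div _ _ hm hp, mul_comm (theta1 τ (u - 1 / 4)) (theta1 τ (u + 1 / 4)), q,
      div_eq_div_iff (by simp [h20, h40]) (mul_ne_zero h20 h40)]
    linear_combination (-(theta2 (2 * τ) (2 * u) * theta4 (2 * τ) 0)) * w
  have e2 : deriv (theta1 (2 * τ)) 0 =
      deriv (theta1 τ) 0 * theta2 τ 0 / (2 * theta4 (2 * τ) 0) := by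
    rw [m0]; field_simp
  rw [energy, e, e2]
  field_simp
  linear_combination (-2 * theta3 (2 * τ) (2 * u)) * s

/-- The values of `r`, `R`, `ℰ` and the coupling constants in terms of positive reals. -/
lemma IsAxisPoint.exists_values {τ u : ℂ} {σ y : ℝ} (hre : τ.re = 0) (him : 0 < τ.im)
    (h : IsAxisPoint τ u σ y) :
    ∃ (b c d p₂ p₃ p₄ : ℝ) (x : ℂ), 0 < b ∧ 0 < c ∧ 0 < d ∧ 0 < p₂ ∧ 0 < p₃ ∧ 0 ≤ p₄ ∧
      r τ u + (r τ u)⁻¹ = 2 * σ * p₄ * b / (p₂ * d) ∧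
      r τ u - (r τ u)⁻¹ = 2 * σ * x * c / (p₂ * d) ∧
      R τ u + (R τ u)⁻¹ = 2 * p₄ * c / (p₃ * d) ∧
      R τ u - (R τ u)⁻¹ = -2 * x * b / (p₃ * d) ∧
      energy τ u = 4 * σ * b * c * p₃ / (p₂ * d ^ 2) ∧
      couplingX τ = (c ^ 2 + b ^ 2) / d ^ 2 ∧ couplingY τ = (c ^ 2 - b ^ 2) / d ^ 2 ∧
      c ^ 2 * p₃ ^ 2 = p₄ ^ 2 * d ^ 2 + b ^ 2 * p₂ ^ 2 ∧ (p₄ = 0 → r τ u = σ * I) := by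
  have hre2 := two_mul_re hre
  have him2 := two_mul_im_pos him
  have im2 : (2 * τ).im = 2 * τ.im := by simp
  have hy2 : |2 * y| ≤ τ.im := by
    rw [abs_mul, abs_two]; linarith [h.abs_le]
  obtain ⟨b, c, d, hb, hc, hd, h2, h3, h4⟩ := theta_constants_pos hre2 him2
  obtain ⟨p₂, hp2, e2⟩ := theta2_imaginary_pos hre2 him2 (2 * y)
  obtain ⟨p₃, hp3, e3⟩ := theta3_imaginary_pos hre2 him2 (2 * y)
  obtain ⟨p₄, hp4, e4⟩ := theta4_imaginary_nonneg hre2 him2 (y := 2 * y) (by rw [im2]; linarith)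
  have e4' := e4
  replace e2 : theta2 (2 * τ) (2 * u) = -σ * p₂ := by rw [h.theta2_eq, e2]
  rw [← h.theta3_eq] at e3
  rw [← h.theta4_eq] at e4
  obtain ⟨n1, n2⟩ := h.theta1_ne_zero hre him
  obtain ⟨n3, n4⟩ := h.theta3_ne_zero hre him
  obtain ⟨s1, s2⟩ := theta1_quarter_sq him u
  obtain ⟨s3, s4⟩ := theta3_quarter_sq him u
  have m1 := theta1_quarter_mul him u
  have m3 := theta3_quarter_mul him u
  have hbC : (b : ℂ) ≠ 0 := by exact_mod_cast hb.ne'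
  have hcC : (c : ℂ) ≠ 0 := by exact_mod_cast hc.ne'
  have hdC : (d : ℂ) ≠ 0 := by exact_mod_cast hd.ne'
  have hp2C : (p₂ : ℂ) ≠ 0 := by exact_mod_cast hp2.ne'
  have hp3C : (p₃ : ℂ) ≠ 0 := by exact_mod_cast hp3.ne'
  have hσ2 : (σ : ℂ) * σ = 1 := by rcases h.sign with h | h <;> simp [h]
  have hσ : (σ : ℂ) ≠ 0 := left_ne_zero_of_mul_eq_one hσ2
  obtain ⟨b₀, c₀, d₀, hb0, hc0, hd0, -, h3', h4'⟩ := theta_constants_pos hre him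
  have hc0C : (c₀ : ℂ) ≠ 0 := by exact_mod_cast hc0.ne'
  have hd0C : (d₀ : ℂ) ≠ 0 := by exact_mod_cast hd0.ne'
  have z3 := theta3_zero_sq him
  have z4 := theta4_zero_sq him
  have z34 := theta4_zero_mul_theta3_zero him
  rw [h3', h3, h2] at z3
  rw [h4', h3, h2] at z4
  rw [h3', h4', h4] at z34
  -- At modulus 2τ, the numbers b, c, d are θ₂, θ₃, θ₄ at 0, and p₂, p₃, p₄ are the same functions
  -- at 2iy.
  refine ⟨b, c, d, p₂, p₃, p₄, theta1 (2 * τ) (2 * u), hb, hc, hd, hp2, hp3, hp4,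
    ?_, ?_, ?_, ?_, ?_, ?_, ?_, ?_, ?_⟩
  · rw [r, div_add_inv_div n1 n2, s1, s2, m1, e2, e4, h2, h4]
    field_simp
    linear_combination (-2 * p₄ * b) * hσ2
  · rw [r, div_sub_inv_div n1 n2, s1, s2, m1, e2, h3, h4]
    field_simp
    linear_combination (-2 * theta1 (2 * τ) (2 * u) * c) * hσ2
  · rw [R, div_add_inv_div n3 n4, s3, s4, m3, e3, e4, h3, h4]
    ring
  · rw [R, div_sub_inv_div n3 n4, s3, s4, m3, e3, h2, h4]
    ring
  · rw [energy_eq hre him n1 n2, e2, e3, h2, h3, h4]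
    field_simp
    linear_combination (-1 : ℂ) * hσ2
  · rw [couplingX, h3', h4', ← z3, ← z34]
    field_simp
  · rw [couplingY, h3', h4', ← z4, ← z34]
    field_simp
  · have := theta_sq_relation him (by rw [h4]; exact hdC) u
    rw [h3, e3, e4, h4, h2, e2] at this
    have hσr : σ * σ = 1 := by exact_mod_cast hσ2
    norm_cast at this
    linear_combination this + b ^ 2 * p₂ ^ 2 * hσr
  · intro hp
    -- Here p₄ = θ₄(2iy | 2τ) can vanish only at the ends of the interval for y, and only the upper
    -- end belongs to it.
    have hy : y = τ.im / 2 := by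
      by_contra hne
      have lt : |y| < τ.im / 2 := abs_lt.2 ⟨h.1, lt_of_le_of_ne h.2.1 hne⟩
      obtain ⟨e, he, hh⟩ := theta4_imaginary_pos hre2 (y := 2 * y) (by
        rw [im2, abs_mul, abs_two]; linarith)
      rw [hh, hp] at e4'
      exact he.ne' (by exact_mod_cast e4')
    have eτ : (y : ℂ) * I = τ / 2 := by
      conv_rhs => rw [eq_im_mul_I hre]
      rw [hy]; push_cast; ring
    rcases h.2.2 with ⟨rfl, hu⟩ | ⟨rfl, hu⟩
    · rw [eτ] at hu
      rw [hu] at n2 ⊢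
      rw [r_half_period him n2]; simp
    · rw [eτ] at hu
      have n := h.isAxisPoint_half_sub.theta1_ne_zero hre him
      rw [hu, sub_sub_cancel] at n
      rw [hu, r_half_sub, r_half_period him n.2]; simp

/-! ### Quasi-momentum and the two forms of 𝒳 -/

lemma exp_momentum {τ u : ℂ} (h : ‖r τ u‖ = 1) : cexp (I * momentum τ u) = r τ u := by
  have h1 : cexp (I * momentum τ u) = cexp (Complex.arg (r τ u) * I) := by
    rw [momentum, toIocMod, Complex.exp_eq_exp_iff_exists_int]
    refine ⟨-toIocDiv Real.two_pi_pos (-(π / 2)) (Complex.arg (r τ u)), ?_⟩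
    push_cast
    simp only [zsmul_eq_mul]
    ring_nf
  rw [h1]
  have := norm_mul_exp_arg_mul_I (r τ u)
  rwa [h, ofReal_one, one_mul] at this

lemma r_add_inv_eq_cos {τ u : ℂ} (h : ‖r τ u‖ = 1) :
    r τ u + (r τ u)⁻¹ = 2 * Real.cos (momentum τ u) := by
  rw [← exp_momentum h, ← Complex.exp_neg, ofReal_cos, Complex.cos]
  ring_nf

lemma r_sub_inv_eq_sin {τ u : ℂ} (h : ‖r τ u‖ = 1) :
    r τ u - (r τ u)⁻¹ = 2 * I * Real.sin (momentum τ u) := by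
  rw [← exp_momentum h, ← Complex.exp_neg, ofReal_sin, Complex.sin]
  ring_nf
  rw [I_sq]
  ring

/-- The cosine of the momentum is σ times a nonnegative number, which fixes the band unless that
number is 0. In the exceptional case r = σi, so p is π/2 for σ = 1 and 3π/2 for σ = -1, in
accordance with the half-open intervals. -/
lemma IsAxisPoint.bandSign_momentum {τ u : ℂ} {σ y : ℝ} (hre : τ.re = 0) (him : 0 < τ.im)
    (h : IsAxisPoint τ u σ y) (hr : ‖r τ u‖ = 1) : bandSign (momentum τ u) = σ := by
  obtain ⟨b, c, d, p₂, p₃, p₄, x, hb, hc, hd, hp2, hp3, hp4, e1, -, -, -, -, -, -, -, e0⟩ :=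
    h.exists_values hre him
  have hm : momentum τ u ∈ Set.Ioc (-(π / 2)) (-(π / 2) + 2 * π) := toIocMod_mem_Ioc _ _ _
  rw [r_add_inv_eq_cos hr] at e1
  have e1' : Real.cos (momentum τ u) = σ * (p₄ * b / (p₂ * d)) := by
    have : (2 * Real.cos (momentum τ u) : ℝ) = 2 * σ * p₄ * b / (p₂ * d) := by
      exact_mod_cast e1
    linear_combination this / 2
  have es := r_sub_inv_eq_sin hr
  rcases hp4.eq_or_lt with h0 | h0
  · have e := e0 h0.symm
    have es2 : Real.sin (momentum τ u) = σ := by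
      rw [e] at es
      have : (σ : ℂ) * I - (σ * I)⁻¹ = 2 * I * σ := by
        rcases h.sign with h | h <;> rw [h] <;> simp <;> ring
      rw [this] at es
      have : (σ : ℂ) = Real.sin (momentum τ u) := by
        have h2 : (2 * I : ℂ) ≠ 0 := by simp
        exact mul_left_cancel₀ h2 es
      exact_mod_cast this.symm
    have ec : Real.cos (momentum τ u) = 0 := by rw [e1', ← h0]; ring
    unfold bandSign
    rcases h.sign with hs | hs
    · rw [if_pos, hs]
      by_contra! hlt
      by_cases hπ : momentum τ u < π
      · have := Real.cos_neg_of_pi_div_two_lt_of_lt hlt (by linarith [Real.pi_pos])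
        linarith
      · push Not at hπ
        have : Real.sin (momentum τ u - 2 * π) ≤ 0 :=
          Real.sin_nonpos_of_nonpos_of_neg_pi_le (by linarith [hm.2, Real.pi_pos]) (by linarith)
        rw [Real.sin_sub_two_pi] at this
        linarith
    · rw [if_neg, hs]
      intro hle
      rcases hle.lt_or_eq with hlt | heq
      · have := Real.cos_pos_of_mem_Ioo ⟨hm.1, hlt⟩
        linarith
      · rw [heq, Real.sin_pi_div_two, hs] at es2
        norm_num at es2
  · have hq : 0 < p₄ * b / (p₂ * d) := by positivity
    unfold bandSign
    rcases h.sign with hs | hs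
    · rw [if_pos, hs]
      by_contra! hlt
      have := Real.cos_nonpos_of_pi_div_two_le_of_le hlt.le (by linarith [hm.2])
      rw [e1', hs] at this
      linarith
    · rw [if_neg, hs]
      intro hle
      have := Real.cos_nonneg_of_mem_Icc ⟨hm.1.le, hle⟩
      rw [e1', hs] at this
      linarith

lemma IsAxisPoint.magX_eq {τ u : ℂ} {σ y : ℝ} (hre : τ.re = 0) (him : 0 < τ.im)
    (h : IsAxisPoint τ u σ y) (hr : ‖r τ u‖ = 1) {ε : ℤ} (hε : ε = 1 ∨ ε = -1) :
    magX τ u ε = I * (1 / (r τ u * R τ u ^ ε) - r τ u * R τ u ^ ε) := by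
  obtain ⟨b, c, d, p₂, p₃, p₄, x, hb, hc, hd, hp2, hp3, hp4, e1, e2, e3, e4, e5, eX, eY, -, -⟩ :=
    h.exists_values hre him
  have eX' : (couplingY τ)⁻¹ = (c ^ 2 + b ^ 2) / d ^ 2 := by
    rw [← eX, couplingX, couplingY, inv_div]
  have hσ2 : (σ : ℂ) * σ = 1 := by rcases h.sign with h | h <;> simp [h]
  have hσ : (σ : ℂ) ≠ 0 := left_ne_zero_of_mul_eq_one hσ2
  have hbC : (b : ℂ) ≠ 0 := by exact_mod_cast hb.ne'
  have hcC : (c : ℂ) ≠ 0 := by exact_mod_cast hc.ne'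
  have hdC : (d : ℂ) ≠ 0 := by exact_mod_cast hd.ne'
  have hp2C : (p₂ : ℂ) ≠ 0 := by exact_mod_cast hp2.ne'
  have hp3C : (p₃ : ℂ) ≠ 0 := by exact_mod_cast hp3.ne'
  have hc1 := r_add_inv_eq_cos hr
  have hs1 := r_sub_inv_eq_sin hr
  rw [e1] at hc1
  rw [e2] at hs1
  have hc2 : (Real.cos (momentum τ u) : ℂ) = σ * p₄ * b / (p₂ * d) := by
    linear_combination -hc1 / 2
  have hs2 : (Real.sin (momentum τ u) : ℂ) = -I * (σ * x * c / (p₂ * d)) := by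
    linear_combination I * hs1 / 2 + Real.sin (momentum τ u) * I_sq
  have h2s : (Real.sin (2 * momentum τ u) : ℂ) =
      2 * (-I * (σ * x * c / (p₂ * d))) * (σ * p₄ * b / (p₂ * d)) := by
    rw [Real.sin_two_mul, ofReal_mul, ofReal_mul, hs2, hc2, ofReal_ofNat]
  rw [magX, h2s, e5]
  set q := r τ u
  set Q := R τ u
  rcases hε with rfl | rfl
  -- This expresses the difference through q ± 1/q and Q ± 1/Q, whose values are known; the
  -- resulting c² - b² is J_y d². For ε = -1 the analogous sum c² + b² is d² / J_y.
  · have key : 1 / (q * Q) - q * Q =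
        -((q + q⁻¹) * (Q - Q⁻¹) + (q - q⁻¹) * (Q + Q⁻¹)) / 2 := by
      rw [one_div, mul_inv]; ring
    rw [zpow_one, zpow_one, key, e1, e2, e3, e4, eY]
    field_simp
    ring
  · have key : 1 / (q * Q⁻¹) - q * Q⁻¹ =
        ((q + q⁻¹) * (Q - Q⁻¹) - (q - q⁻¹) * (Q + Q⁻¹)) / 2 := by
      rw [one_div, mul_inv, inv_inv]; ring
    rw [zpow_neg_one, zpow_neg_one, key, e1, e2, e3, e4, eX']
    field_simp
    ring

/-- By the quadratic theta relation, the radicand is the square of b c p₃ / (p₂ d²), which is σℰ/4.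
Thus ℰ is four times the band sign times the square root. -/
lemma IsAxisPoint.magX_eq_real {τ u : ℂ} {σ y : ℝ} (hre : τ.re = 0) (him : 0 < τ.im)
    (h : IsAxisPoint τ u σ y) (hr : ‖r τ u‖ = 1) {Jx Jy : ℝ} (hJx : (Jx : ℂ) = couplingX τ)
    (hJy : (Jy : ℂ) = couplingY τ) (ε : ℤ) :
    magX τ u ε = ((Jy ^ ε * (bandSign (momentum τ u) * (Real.sin (2 * momentum τ u) /
      Real.sqrt (Real.cos (momentum τ u) ^ 2 + ((Jx - Jy) / 2) ^ 2))) : ℝ) : ℂ) := by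
  obtain ⟨b, c, d, p₂, p₃, p₄, x, hb, hc, hd, hp2, hp3, hp4, e1, -, -, -, e5, eX, eY, e, -⟩ :=
    h.exists_values hre him
  have hσ2 : σ * σ = 1 := by rcases h.sign with h | h <;> simp [h]
  rw [r_add_inv_eq_cos hr] at e1
  have e1' : Real.cos (momentum τ u) = σ * p₄ * b / (p₂ * d) := by
    have : (2 * Real.cos (momentum τ u) : ℝ) = 2 * σ * p₄ * b / (p₂ * d) := by
      exact_mod_cast e1
    linear_combination this / 2
  have hδ : (Jx - Jy) / 2 = b ^ 2 / d ^ 2 := by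
    rw [← hJx] at eX
    rw [← hJy] at eY
    norm_cast at eX eY
    rw [eX, eY]; ring
  have hs : Real.cos (momentum τ u) ^ 2 + ((Jx - Jy) / 2) ^ 2 =
      (b * c * p₃ / (p₂ * d ^ 2)) ^ 2 := by
    rw [e1', hδ]
    field_simp
    linear_combination p₄ ^ 2 * d ^ 2 * hσ2 - e
  rw [hs, Real.sqrt_sq (by positivity), h.bandSign_momentum hre him hr, magX, e5, ← hJy]
  have hσ : σ ≠ 0 := left_ne_zero_of_mul_eq_one hσ2
  norm_cast
  field_simp
  linear_combination (-Jy ^ ε * Real.sin (2 * momentum τ u)) * hσ2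

/-- R + 1/R is nonnegative. As |R| = 1, this keeps R off the branch cut of the square root, so that
the roots of R and 1/R are inverse to each other and the amplitudes take the same form on both
sublattices. -/
lemma IsAxisPoint.R_ne_neg_one {τ u : ℂ} {σ y : ℝ} (hre : τ.re = 0) (him : 0 < τ.im)
    (h : IsAxisPoint τ u σ y) : R τ u ≠ -1 := by
  obtain ⟨b, c, d, p₂, p₃, p₄, x, hb, hc, hd, hp2, hp3, hp4, -, -, e3, -⟩ :=
    h.exists_values hre him
  intro hR
  rw [hR] at e3
  have : (-2 : ℝ) = 2 * p₄ * c / (p₃ * d) := by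
    have : (-2 : ℂ) = 2 * p₄ * c / (p₃ * d) := by rw [← e3]; norm_num
    exact_mod_cast this
  have h2 : 0 ≤ 2 * p₄ * c / (p₃ * d) := by positivity
  linarith

/-! ### One-particle amplitudes and their orthogonality -/

/-- `m` is the cyclic predecessor of the site `n`. -/
def IsPrev {N : ℕ} (m n : Fin N) : Prop :=
  (m : ℕ) + 1 = n ∨ ((n : ℕ) = 0 ∧ (m : ℕ) + 1 = N)

/-- The sign acquired by an amplitude on being transported across the boundary of the chain. -/
def wrapSign {N : ℕ} (ξ : ℕ) (n : Fin N) : ℤ := if (n : ℕ) = 0 then (-1) ^ (ξ + 1) else 1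

lemma IsAxisPoint.amplitude_eq {N : ℕ} {τ u : ℂ} {σ y : ℝ} (hre : τ.re = 0) (him : 0 < τ.im)
    (h : IsAxisPoint τ u σ y) (n : Fin N) :
    amplitude τ n u = r τ u ^ label n * (R τ u ^ (1 / 2 : ℂ)) ^ parity n := by
  rw [amplitude]
  congr 1
  rcases neg_one_pow_eq_or ℤ (label n) with hp | hp
  · rw [parity, hp, Int.cast_one, zpow_one, R]
  · rw [parity, hp, zpow_neg_one, ← Complex.inv_cpow, R, inv_div]
    · push_cast
      congr 4 <;> ring
    · intro hπ
      rw [Complex.arg_eq_pi_iff] at hπ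
      apply h.R_ne_neg_one hre him
      have := h.norm_R hre him
      have e : R τ u = ((R τ u).re : ℂ) := by apply Complex.ext <;> simp [hπ.2]
      rw [e, norm_real, Real.norm_of_nonpos hπ.1.le] at this
      rw [e, ← neg_neg (R τ u).re, this]
      simp

lemma IsAxisPoint.sqrt_R_ne_zero {τ u : ℂ} {σ y : ℝ} (hre : τ.re = 0) (him : 0 < τ.im)
    (h : IsAxisPoint τ u σ y) : R τ u ^ (1 / 2 : ℂ) ≠ 0 := by
  rw [Ne, Complex.cpow_eq_zero_iff]
  have := h.norm_R hre him
  rintro ⟨h0, -⟩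
  rw [h0, norm_zero] at this
  exact zero_ne_one this

lemma IsAxisPoint.norm_amplitude {N : ℕ} {τ u : ℂ} {σ y : ℝ} (hre : τ.re = 0) (him : 0 < τ.im)
    (h : IsAxisPoint τ u σ y) (hr : ‖r τ u‖ = 1) (n : Fin N) : ‖amplitude τ n u‖ = 1 := by
  have hs : ‖R τ u ^ (1 / 2 : ℂ)‖ = 1 := by
    have hR := h.norm_R hre him
    have : (R τ u ^ (1 / 2 : ℂ)) ^ 2 = R τ u := by
      rw [one_div]; exact Complex.cpow_nat_inv_pow _ two_ne_zero
    have := congrArg norm this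
    rw [norm_pow, hR] at this
    exact (pow_eq_one_iff_of_nonneg (norm_nonneg _) two_ne_zero).1 this
  rw [h.amplitude_eq hre him, norm_mul, norm_pow, norm_zpow, hr, hs, one_pow, one_zpow, one_mul]

lemma conj_eq_inv_of_norm_eq_one {z : ℂ} (h : ‖z‖ = 1) : conj z = z⁻¹ := by
  rw [Complex.inv_def, normSq_eq_norm_sq, h]; simp

/-- Transporting an amplitude to the preceding site. -/
lemma IsAxisPoint.wrapSign_mul_amplitude {N ξ : ℕ} {τ u : ℂ} {σ y : ℝ} (hre : τ.re = 0)
    (him : 0 < τ.im) (h : IsAxisPoint τ u σ y) (hN : Even N)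
    (hb : r τ u ^ N = (-1) ^ (ξ + 1)) {m n : Fin N} (hmn : IsPrev m n) :
    (wrapSign ξ n : ℂ) * ((amplitude τ n u)⁻¹ * amplitude τ m u) =
      1 / (r τ u * R τ u ^ parity n) := by
  have hs := h.sqrt_R_ne_zero hre him
  have hs2 : (R τ u ^ (1 / 2 : ℂ)) ^ 2 = R τ u := by
    rw [one_div]; exact Complex.cpow_nat_inv_pow _ two_ne_zero
  have hr0 : r τ u ≠ 0 := by
    intro h0
    rw [h0, zero_pow (Fin.pos n).ne'] at hb
    exact pow_ne_zero _ (by norm_num) hb.symm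
  rw [h.amplitude_eq hre him, h.amplitude_eq hre him]
  set s := R τ u ^ (1 / 2 : ℂ)
  rw [← hs2, wrapSign]
  rcases hmn with hmn | ⟨h0, hm⟩
  · have hl : label n = label m + 1 := by simp only [label]; omega
    have hp : parity m = -parity n := by simp only [parity, hl, pow_succ]; ring
    rw [if_neg (by omega), hl, hp]
    rcases neg_one_pow_eq_or ℤ (label n) with hp | hp <;>
    · rw [parity, hp]
      simp only [zpow_one, zpow_neg_one, neg_neg, Int.cast_one, one_mul]
      field_simp
      rw [pow_succ]
  · have hl : label n = 1 := by simp only [label]; omega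
    have hl' : label m = N := hm
    have hpn : parity n = -1 := by simp [parity, hl]
    have hpm : parity m = 1 := by simp [parity, hl', hN.neg_one_pow]
    rw [if_pos h0, hpn, hpm, hl, hl', hb]
    simp only [zpow_one, zpow_neg_one, pow_one]
    push_cast
    field_simp
    rw [← pow_mul, mul_comm, pow_mul, neg_one_sq, one_pow]

/-- The summand has period N and is multiplied by z² under a shift by two sites, so (z² - 1) times
the sum telescopes to zero. The case z = -1 escapes this argument, and there g = 1 leaves an
alternating sum of even length. -/
lemma sum_alternating_geometric_eq_zero {N : ℕ} (hN : Even N) {z g : ℂ} (hz : z ^ N = 1)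
    (hz1 : z ≠ 1) (hg : z = -1 → g = 1) :
    ∑ m ∈ Finset.range N, z ^ (m + 1) * g ^ ((-1 : ℤ) ^ (m + 1)) = 0 := by
  by_cases h : z = -1
  · rw [hg h, h]
    simp only [one_zpow, mul_one, pow_succ, ← Finset.sum_mul, neg_one_geom_sum, if_pos hN, zero_mul]
  · have h2 : z ^ 2 - 1 ≠ 0 := by
      intro h0
      rcases (by simpa using sub_eq_zero.1 h0 : z = 1 ∨ z = -1) with h' | h' <;> contradiction
    set a : ℕ → ℂ := fun m => z ^ m * g ^ ((-1 : ℤ) ^ m) with ha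
    have step : ∀ m, a (m + 2) = z ^ 2 * a m := fun m => by
      simp only [ha, pow_add, neg_one_sq, mul_one]; ring
    have per : ∀ m, a (m + N) = a m := fun m => by
      simp only [ha, pow_add, hz, hN.neg_one_pow, mul_one]
    have t := Finset.sum_range_sub (fun m => a (m + 1) + a (m + 2)) N
    have e : ∀ m, a (m + 1 + 1) + a (m + 1 + 2) - (a (m + 1) + a (m + 2)) =
        (z ^ 2 - 1) * a (m + 1) := fun m => by rw [step (m + 1)]; ring
    simp only [e, ← Finset.mul_sum] at t
    rw [show N + 1 = 0 + 1 + N by ring, show N + 2 = 0 + 2 + N by ring, per, per, sub_self] at t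
    exact (mul_eq_zero.1 t).resolve_left h2

lemma IsBetheTuple.norm_r {τ : ℂ} {N ξ M : ℕ} {u : Fin M → ℂ} (hN : 0 < N)
    (hu : IsBetheTuple τ N ξ u) (l : Fin M) : ‖r τ (u l)‖ = 1 :=
  norm_eq_one_of_pow_eq hN (hu.bethe_eq l)

lemma IsBetheTuple.exists_isAxisPoint {τ : ℂ} {N ξ M : ℕ} {u : Fin M → ℂ} (hre : τ.re = 0)
    (him : 0 < τ.im) (hN : 0 < N) (hu : IsBetheTuple τ N ξ u) (l : Fin M) :
    ∃ σ y, IsAxisPoint τ (u l) σ y :=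
  XYChain.exists_isAxisPoint hre him (hu.mem_domain l) (hu.norm_r hN l)

/-- The one-particle amplitudes of distinct Bethe roots are orthogonal. -/
lemma IsBetheTuple.sum_conj_amplitude_mul {τ : ℂ} {N ξ M : ℕ} {u : Fin M → ℂ} (hre : τ.re = 0)
    (him : 0 < τ.im) (hN : 0 < N) (hNe : Even N) (hu : IsBetheTuple τ N ξ u) (l k : Fin M) :
    ∑ n : Fin N, conj (amplitude τ n (u l)) * amplitude τ n (u k) =
      if l = k then (N : ℂ) else 0 := by
  obtain ⟨σ, y, hl⟩ := hu.exists_isAxisPoint hre him hN l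
  obtain ⟨σ', y', hk⟩ := hu.exists_isAxisPoint hre him hN k
  have hc : ∀ n : Fin N, conj (amplitude τ n (u l)) = (amplitude τ n (u l))⁻¹ := fun n =>
    conj_eq_inv_of_norm_eq_one (hl.norm_amplitude hre him (hu.norm_r hN l) n)
  simp only [hc]
  split_ifs with h
  · subst h
    have : ∀ n : Fin N, (amplitude τ n (u l))⁻¹ * amplitude τ n (u l) = 1 := fun n => by
      refine inv_mul_cancel₀ (norm_ne_zero_iff.1 ?_)
      rw [hl.norm_amplitude hre him (hu.norm_r hN l) n]
      exact one_ne_zero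
    simp [this]
  · have hne : u l ≠ u k := fun e => h (hu.injective e)
    have hr0 : r τ (u l) ≠ 0 := norm_ne_zero_iff.1 (by rw [hu.norm_r hN l]; exact one_ne_zero)
    set s := R τ (u l) ^ (1 / 2 : ℂ) with hs
    set s' := R τ (u k) ^ (1 / 2 : ℂ) with hs'
    have hs0 : s ≠ 0 := hl.sqrt_R_ne_zero hre him
    have e : ∀ n : Fin N, (amplitude τ n (u l))⁻¹ * amplitude τ n (u k) =
        (r τ (u k) / r τ (u l)) ^ ((n : ℕ) + 1) * (s' / s) ^ ((-1 : ℤ) ^ ((n : ℕ) + 1)) := by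
      intro n
      rw [hl.amplitude_eq hre him, hk.amplitude_eq hre him, div_pow, div_zpow]
      simp only [label, parity, ← hs, ← hs']
      have := zpow_ne_zero ((-1 : ℤ) ^ ((n : ℕ) + 1)) hs0
      field_simp
    -- If the ratio of the r-values is ±1, distinct roots must be reflections of each other. The
    -- reflection gives ratio -1, excluding +1, and leaves R unchanged, so the alternating factor is
    -- 1.
    have key : ∀ {a : ℂ}, r τ (u k) / r τ (u l) = a → a ^ 2 = 1 → u k = 1 / 2 - u l := by
      intro a ha h2
      have : r τ (u k) = a * r τ (u l) := by rw [← ha, div_mul_cancel₀ _ hr0]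
      exact (hl.eq_or_eq_half_sub hre him hk (by rw [this, mul_pow, h2, one_mul])).resolve_left
        (Ne.symm hne)
    simp only [e]
    rw [Fin.sum_univ_eq_sum_range
      (fun n => (r τ (u k) / r τ (u l)) ^ (n + 1) * (s' / s) ^ ((-1 : ℤ) ^ (n + 1))) N]
    refine sum_alternating_geometric_eq_zero hNe ?_ ?_ ?_
    · rw [div_pow, hu.bethe_eq, hu.bethe_eq, div_self (pow_ne_zero _ (by norm_num))]
    · intro h1
      have hk' := key h1 (by norm_num)
      rw [hk', r_half_sub, neg_div, div_self hr0] at h1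
      norm_num at h1
    · intro h1
      have hk' := key h1 (by norm_num)
      rw [hs', hk', R_half_sub, ← hs, div_self hs0]

/-! ### Cauchy–Binet and one-body operators in Slater determinants -/

open Classical in
/-- The Cauchy–Binet formula, with the minors indexed by strictly increasing tuples. -/
lemma det_mul_eq_sum_strictMono {M N : ℕ} {K : Type*} [CommRing K]
    (A : Matrix (Fin M) (Fin N) K) (B : Matrix (Fin N) (Fin M) K) :
    (A * B).det = ∑ S ∈ (Finset.univ : Finset (Fin M → Fin N)).filter (fun S => StrictMono S),
      (A.submatrix id S).det * (B.submatrix S id).det := by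
  have h1 : (A * B).det = ∑ f : Fin M → Fin N, (∏ j, A j (f j)) * (B.submatrix f id).det := by
    have e : A * B = Matrix.of fun j => ∑ k, A j k • B k := by
      ext j l
      simp [Matrix.mul_apply, Finset.sum_apply]
    rw [e]
    change (Matrix.detRowAlternating (R := K)).toMultilinearMap (fun j => ∑ k, A j k • B k) = _
    rw [MultilinearMap.map_sum]
    refine Finset.sum_congr rfl fun f _ => ?_
    rw [MultilinearMap.map_smul_univ]
    rfl
  have h2 : ∑ f : Fin M → Fin N, (∏ j, A j (f j)) * (B.submatrix f id).det =
      ∑ f ∈ (Finset.univ : Finset (Fin M → Fin N)).filter (fun f => Function.Injective f),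
        (∏ j, A j (f j)) * (B.submatrix f id).det := by
    rw [Finset.sum_filter]
    refine Finset.sum_congr rfl fun f _ => ?_
    split_ifs with hf
    · rfl
    · rw [Function.Injective] at hf
      push Not at hf
      obtain ⟨i, j, hij, hne⟩ := hf
      rw [Matrix.det_zero_of_row_eq hne (by ext l; simp [hij]), mul_zero]
  have h3 : ∀ S : Fin M → Fin N, (A.submatrix id S).det * (B.submatrix S id).det =
      ∑ σ : Equiv.Perm (Fin M), (∏ j, A j (S (σ j))) * (B.submatrix (S ∘ σ) id).det := by
    intro S
    rw [← Matrix.det_transpose (A.submatrix id S), Matrix.det_apply', Finset.sum_mul]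
    refine Finset.sum_congr rfl fun σ _ => ?_
    have : B.submatrix (S ∘ σ) id = (B.submatrix S id).submatrix σ id := rfl
    rw [this, Matrix.det_permute]
    simp only [Matrix.transpose_apply, Matrix.submatrix_apply, id]
    ring
  rw [h1, h2]
  simp only [h3]
  rw [← Finset.sum_product']
  symm
  -- An injective tuple is uniquely an increasing tuple composed with a permutation, namely the
  -- inverse of the one that sorts it.
  refine Finset.sum_bij' (fun p _ => p.1 ∘ p.2) (fun f _ => (f ∘ Tuple.sort f, (Tuple.sort f)⁻¹))
    ?_ ?_ ?_ ?_ ?_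
  · rintro ⟨S, σ⟩ hp
    simp only [Finset.mem_product, Finset.mem_filter, Finset.mem_univ, true_and, and_true] at hp ⊢
    exact hp.injective.comp σ.injective
  · intro f hf
    simp only [Finset.mem_product, Finset.mem_filter, Finset.mem_univ, true_and, and_true] at hf ⊢
    exact (Tuple.monotone_sort f).strictMono_of_injective (hf.comp (Tuple.sort f).injective)
  · rintro ⟨S, σ⟩ hp
    simp only [Finset.mem_product, Finset.mem_filter, Finset.mem_univ, true_and, and_true] at hp
    have h : Tuple.sort (S ∘ σ) = σ⁻¹ := by
      have hm : Monotone ((S ∘ σ) ∘ (σ⁻¹ : Equiv.Perm (Fin M))) := by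
        have : (S ∘ σ) ∘ (σ⁻¹ : Equiv.Perm (Fin M)) = S := by ext; simp
        rw [this]; exact hp.monotone
      have := Tuple.comp_sort_eq_comp_iff_monotone.2 hm
      ext i
      have hi := congrFun this i
      have := (hp.injective.comp σ.injective) hi
      rw [this]
    simp only [h, inv_inv, Prod.mk.injEq, and_true]
    ext; simp
  · intro f _
    ext; simp
  · intros; rfl

open Classical in
/-- The matrix element of a one-particle hopping operator in a Slater determinant. -/
lemma sum_conj_det_mul_det_update {M N : ℕ} {c : ℂ} (hc : c ≠ 0) (V : Matrix (Fin N) (Fin M) ℂ)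
    (hV : V.conjTranspose * V = c • (1 : Matrix (Fin M) (Fin M) ℂ)) (n m : Fin N) :
    ∑ S ∈ (Finset.univ : Finset (Fin M → Fin N)).filter (fun S => StrictMono S),
      conj (V.submatrix S id).det *
        ∑ j, (if S j = n then (V.submatrix (Function.update S j m) id).det else 0) =
      c ^ M * (c⁻¹ * ∑ l, conj (V n l) * V m l) := by
  -- W is V with row m added to row n. The minors of W minus those of V are the hopped minors, by
  -- linearity in one row; Cauchy–Binet then leaves the determinant of c times a rank-one
  -- perturbation of the identity.
  set W : Matrix (Fin N) (Fin M) ℂ := V.updateRow n (V n + V m) with hW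
  have hconj : ∀ S : Fin M → Fin N, conj (V.submatrix S id).det =
      (V.conjTranspose.submatrix id S).det := by
    intro S
    rw [← Matrix.conjTranspose_submatrix, Matrix.det_conjTranspose]
    rfl
  have hdet : ∀ S : Fin M → Fin N, StrictMono S →
      ∑ j, (if S j = n then (V.submatrix (Function.update S j m) id).det else 0) =
        (W.submatrix S id).det - (V.submatrix S id).det := by
    intro S hS
    by_cases h : ∃ j, S j = n
    · obtain ⟨j, hj⟩ := h
      rw [Finset.sum_eq_single j (fun i _ hi => if_neg fun h => hi (hS.injective (h.trans hj.symm)))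
        (by simp), if_pos hj]
      have e1 : W.submatrix S id = (V.submatrix S id).updateRow j (V n + V m) := by
        ext i l
        by_cases hi : i = j
        · subst hi; simp [hW, hj]
        · have : S i ≠ n := fun h => hi (hS.injective (h.trans hj.symm))
          simp [hW, hi, this]
      have e2 : V.submatrix (Function.update S j m) id = (V.submatrix S id).updateRow j (V m) := by
        ext i l
        by_cases hi : i = j
        · subst hi; simp
        · simp [hi]
      have e3 : (V.submatrix S id).updateRow j (V n) = V.submatrix S id := by
        ext i l
        by_cases hi : i = j
        · subst hi; simp [hj]
        · simp [hi]
      rw [e1, e2, Matrix.det_updateRow_add, e3]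
      ring
    · push Not at h
      have e1 : W.submatrix S id = V.submatrix S id := by
        ext i l
        simp [hW, h i]
      rw [e1, sub_self]
      exact Finset.sum_eq_zero fun j _ => if_neg (h j)
  have hWV : V.conjTranspose * W = c • (1 + Matrix.replicateCol Unit (c⁻¹ • star (V n)) *
      Matrix.replicateRow Unit (V m)) := by
    have : W = V + Matrix.vecMulVec (Pi.single n 1) (V m) := by
      ext i l
      by_cases hi : i = n
      · subst hi; simp [hW, Matrix.vecMulVec_apply]
      · simp [hW, hi, Matrix.vecMulVec_apply]
    rw [this, Matrix.mul_add, hV, smul_add]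
    congr 1
    ext i l
    simp [Matrix.mul_apply, Matrix.vecMulVec_apply, Pi.single_apply, hc]
  rw [Finset.sum_congr rfl fun S hS => by
    rw [hdet S (Finset.mem_filter.1 hS).2, hconj, mul_sub], Finset.sum_sub_distrib,
    ← det_mul_eq_sum_strictMono, ← det_mul_eq_sum_strictMono, hWV, hV, Matrix.det_smul,
    Matrix.det_smul, Matrix.det_one_add_replicateCol_mul_replicateRow, Matrix.det_one,
    Fintype.card_fin]
  simp only [dotProduct, Pi.smul_apply, Pi.star_apply, smul_eq_mul, Finset.mul_sum]
  rw [← mul_sub, add_sub_cancel_left, Finset.mul_sum]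
  refine Finset.sum_congr rfl fun l _ => ?_
  rw [starRingEnd_apply]
  ring

/-! ### The spin-flip parity -/

/-- The eigenvalue of `∏ σ_n^z` on a basis state. -/
def spinParity {N : ℕ} (s : Fin N → Fin 2) : ℤ := ∏ m, (-1) ^ (s m : ℕ)

lemma spinParity_eq_or {N : ℕ} (s : Fin N → Fin 2) : spinParity s = 1 ∨ spinParity s = -1 := by
  rw [spinParity, Finset.prod_pow_eq_pow_sum]
  exact neg_one_pow_eq_or ℤ _

lemma sigma_apply_ne_zero {N : ℕ} {α : Axis} {n : Fin N} {s t : Fin N → Fin 2}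
    (h : sigma α n s t ≠ 0) : pauli α (s n) (t n) ≠ 0 ∧ ∀ m, m ≠ n → s m = t m := by
  simp only [sigma, Matrix.of_apply] at h
  refine ⟨left_ne_zero_of_mul h, fun m hm => ?_⟩
  have := Finset.prod_ne_zero_iff.1 (right_ne_zero_of_mul h) m (by simp [hm])
  by_contra hne
  exact this (if_neg hne)

lemma spinParity_of_sigma_ne_zero {N : ℕ} {α : Axis} (hα : α = Axis.x ∨ α = Axis.y) {n : Fin N}
    {s t : Fin N → Fin 2} (h : sigma α n s t ≠ 0) : spinParity s = -spinParity t := by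
  obtain ⟨h1, h2⟩ := sigma_apply_ne_zero h
  rw [spinParity, spinParity, ← Finset.mul_prod_erase _ _ (Finset.mem_univ n),
    ← Finset.mul_prod_erase Finset.univ (fun m => (-1 : ℤ) ^ (t m : ℕ)) (Finset.mem_univ n),
    Finset.prod_congr rfl fun m hm => by rw [h2 m (Finset.ne_of_mem_erase hm)], ← neg_mul]
  congr 1
  generalize s n = a at h1 ⊢
  generalize t n = b at h1 ⊢
  rcases hα with rfl | rfl <;> fin_cases a <;> fin_cases b <;> simp_all [pauli]

lemma spinParity_of_prod_ne_zero {N : ℕ} (L : List (Matrix (Fin N → Fin 2) (Fin N → Fin 2) ℂ))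
    (hL : ∀ A ∈ L, ∀ s t, A s t ≠ 0 → spinParity s = -spinParity t) {s t : Fin N → Fin 2}
    (h : L.prod s t ≠ 0) : spinParity s = (-1) ^ L.length * spinParity t := by
  induction L generalizing s with
  | nil =>
    rw [List.prod_nil] at h
    have : s = t := by
      by_contra hne
      exact h (Matrix.one_apply_ne hne)
    simp [this]
  | cons A L ih =>
    rw [List.prod_cons, Matrix.mul_apply] at h
    obtain ⟨x, -, hx⟩ := Finset.exists_ne_zero_of_sum_ne_zero h
    rw [hL A (by simp) s x (left_ne_zero_of_mul hx),
      ih (fun B hB => hL B (by simp [hB])) (right_ne_zero_of_mul hx), List.length_cons, pow_succ]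
    ring

lemma localState_add_two (v : ℤ) (t : Fin 2) :
    localState (v + 2) t = (-1) ^ (t : ℕ) * localState v t := by
  fin_cases t
  · simp [localState]
  · simp only [localState, Fin.mk_one, Matrix.cons_val_one, Matrix.cons_val_fin_one, pow_one]
    rw [zpow_add₀ I_ne_zero, show (I : ℂ) ^ (2 : ℤ) = -1 from I_sq]
    ring

lemma chiralVector_neg_one {N M : ℕ} (S : Fin M → Fin N) (s : Fin N → Fin 2) :
    chiralVector (-1) S s = spinParity s * chiralVector 1 S s := by
  simp only [chiralVector, spinParity]
  push_cast
  rw [mul_left_comm, ← Finset.prod_mul_distrib]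
  congr 1
  refine Finset.prod_congr rfl fun l _ => ?_
  rw [← localState_add_two]
  congr 1
  ring

/-- By `chiralVector_neg_one`, summing over κ multiplies the κ = 1 component at s by 1 + (-1)^ξ
times the parity of s, which vanishes in the wrong parity sector. -/
lemma spinParity_of_betheVector_ne_zero {τ : ℂ} {N ξ M : ℕ} {u : Fin M → ℂ} {s : Fin N → Fin 2}
    (h : betheVector τ N ξ u s ≠ 0) : spinParity s = (-1) ^ ξ := by
  by_contra hne
  have hp : spinParity s = -(-1) ^ ξ := by
    rcases spinParity_eq_or s with h | h <;> rcases neg_one_pow_eq_or ℤ ξ with h' | h' <;>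
      rw [h, h'] at hne ⊢ <;> simp at hne ⊢
  apply h
  rw [betheVector, Finset.sum_apply]
  refine Finset.sum_eq_zero fun S _ => ?_
  rw [Finset.sum_pair (by norm_num), Pi.add_apply, Pi.smul_apply, Pi.smul_apply,
    chiralVector_neg_one, hp]
  simp only [smul_eq_mul]
  push_cast
  have : ((-1 : ℂ) ^ ξ) * (-1) ^ ξ = 1 := by rw [← mul_pow]; simp
  rw [one_pow]
  linear_combination (-chi τ u S * chiralVector 1 S s) * this

lemma expectation_eq_zero_of_spinParity {τ : ℂ} {N ξ M : ℕ} {u : Fin M → ℂ}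
    {A : Matrix (Fin N → Fin 2) (Fin N → Fin 2) ℂ}
    (hA : ∀ s t, A s t ≠ 0 → spinParity s = -spinParity t) :
    expectation A (betheVector τ N ξ u) = 0 := by
  rw [expectation, dotProduct]
  refine Finset.sum_eq_zero fun s _ => ?_
  rw [Matrix.mulVec, dotProduct, Finset.mul_sum]
  refine Finset.sum_eq_zero fun t _ => ?_
  by_contra h
  have h1 := left_ne_zero_of_mul h
  have h2 := right_ne_zero_of_mul h
  rw [Pi.star_apply, star_ne_zero] at h1
  have := hA s t (left_ne_zero_of_mul h2)
  rw [spinParity_of_betheVector_ne_zero h1,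
    spinParity_of_betheVector_ne_zero (right_ne_zero_of_mul h2)] at this
  exact pow_ne_zero ξ (by norm_num : (-1 : ℤ) ≠ 0) (self_eq_neg.1 this)

/-! ### Matrix elements of `σ_n^z` in the chiral basis -/

lemma sigma_z_mulVec {N : ℕ} (n : Fin N) (Ψ : (Fin N → Fin 2) → ℂ) (s : Fin N → Fin 2) :
    (sigma Axis.z n).mulVec Ψ s = (-1) ^ (s n : ℕ) * Ψ s := by
  rw [Matrix.mulVec, dotProduct, Finset.sum_eq_single s]
  · congr 1
    simp only [sigma, Matrix.of_apply, if_true, Finset.prod_const_one, mul_one]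
    generalize s n = a
    fin_cases a <;> simp [pauli]
  · intro t _ ht
    by_contra h
    obtain ⟨h1, h2⟩ := sigma_apply_ne_zero (left_ne_zero_of_mul h)
    apply ht
    funext m
    by_cases hm : m = n
    · subst hm
      generalize s m = a at h1 ⊢
      generalize t m = b at h1 ⊢
      fin_cases a <;> fin_cases b <;> simp_all [pauli]
    · exact (h2 m hm).symm
  · simp

/-- The sign that determines the local state of a chiral basis vector at the site `l`. -/
def chiralSign {N M : ℕ} (κ : ℤ) (S : Fin M → Fin N) (l : Fin N) : ℤ :=
  κ * (-1) ^ (Finset.univ.filter fun j => S j < l).card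

/-- `-1` at the site `n`, and `1` elsewhere. -/
def flipSign {N : ℕ} (n l : Fin N) : ℤ := if l = n then -1 else 1

lemma conj_I_zpow_mul (v v' : ℤ) : conj (I ^ v) * I ^ v' = I ^ (v' - v) := by
  rw [map_zpow₀, conj_I, ← inv_I, inv_zpow, zpow_sub₀ I_ne_zero]
  field_simp

/-- At one site the arguments of ψ in two chiral vectors differ by an even integer, so the relative
phase of the lower components is a sign. This is what makes the local states equal or orthogonal. -/
lemma I_zpow_sub_eq_sign {κ κ' : ℤ} (hκ : κ = 1 ∨ κ = -1)
    (hκ' : κ' = 1 ∨ κ' = -1) (a k k' : ℕ) :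
    I ^ (((a : ℤ) - 2 * k' - κ') - ((a : ℤ) - 2 * k - κ)) =
      ((κ * (-1) ^ k * (κ' * (-1) ^ k') : ℤ) : ℂ) := by
  obtain ⟨e, he, hs⟩ : ∃ e : ℤ, κ - κ' = 2 * e ∧ (((-1 : ℂ) ^ e) = κ * κ') := by
    rcases hκ with rfl | rfl <;> rcases hκ' with rfl | rfl
    · exact ⟨0, by norm_num, by norm_num⟩
    · exact ⟨1, by norm_num, by norm_num⟩
    · exact ⟨-1, by norm_num, by norm_num⟩
    · exact ⟨0, by norm_num, by norm_num⟩
  rw [show ((a : ℤ) - 2 * k' - κ') - ((a : ℤ) - 2 * k - κ) = 2 * ((k : ℤ) + -(k' : ℤ) + e) by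
    linear_combination he, zpow_mul, show (I : ℂ) ^ (2 : ℤ) = -1 from I_sq,
    zpow_add₀ (by norm_num), zpow_add₀ (by norm_num), hs, zpow_neg, zpow_natCast, zpow_natCast]
  have : (((-1 : ℂ) ^ k')⁻¹) = (-1) ^ k' := by rw [← inv_pow]; norm_num
  rw [this]
  push_cast
  ring

-- The product states factor the matrix element over sites. The local overlap is (1 + 1)/2 or (1 -
-- 1)/2 according to the relative sign, with an extra -1 from σ^z at n, so the product is an
-- indicator times the phases of the two vectors.
open Classical in
lemma chiralVector_sigma_z {N M : ℕ} {κ κ' : ℤ} (hκ : κ = 1 ∨ κ = -1) (hκ' : κ' = 1 ∨ κ' = -1)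
    (S S' : Fin M → Fin N) (n : Fin N) :
    star (chiralVector κ S) ⬝ᵥ (sigma Axis.z n).mulVec (chiralVector κ' S') =
      I ^ (∑ j, label (S j)) * (-I) ^ (∑ j, label (S' j)) *
        if ∀ l, chiralSign κ S l * chiralSign κ' S' l = flipSign n l then 1 else 0 := by
  set v : Fin N → ℤ := fun l =>
    (label l : ℤ) - 2 * ((Finset.univ.filter fun j => S j < l).card : ℤ) - κ with hv
  set v' : Fin N → ℤ := fun l =>
    (label l : ℤ) - 2 * ((Finset.univ.filter fun j => S' j < l).card : ℤ) - κ' with hv'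
  have h2 : (Real.sqrt 2 : ℂ) * Real.sqrt 2 = 2 := by
    norm_cast; exact Real.mul_self_sqrt (by norm_num)
  have h20 : (Real.sqrt 2 : ℂ) ≠ 0 := by
    intro h; rw [h, mul_zero] at h2; norm_num at h2
  have hI : ∀ l, conj (I ^ v l) * I ^ v' l = ((chiralSign κ S l * chiralSign κ' S' l : ℤ) : ℂ) :=
    fun l => by
      rw [conj_I_zpow_mul]
      exact I_zpow_sub_eq_sign hκ hκ' (label l) _ _
  have hloc : ∀ l, ∑ t : Fin 2, conj (localState (v l) t) *
      ((if l = n then (-1) ^ (t : ℕ) else 1) * localState (v' l) t) =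
      if chiralSign κ S l * chiralSign κ' S' l = flipSign n l then 1 else 0 := by
    intro l
    have hs : chiralSign κ S l * chiralSign κ' S' l = 1 ∨
        chiralSign κ S l * chiralSign κ' S' l = -1 := by
      simp only [chiralSign]
      rcases hκ with rfl | rfl <;> rcases hκ' with rfl | rfl <;>
      rcases neg_one_pow_eq_or ℤ (Finset.univ.filter fun j => S j < l).card with h | h <;>
      rcases neg_one_pow_eq_or ℤ (Finset.univ.filter fun j => S' j < l).card with h' | h' <;>
      rw [h, h'] <;> norm_num
    have e := hI l
    rw [Fin.sum_univ_two]
    simp only [localState, Matrix.cons_val_zero, Matrix.cons_val_one, Matrix.cons_val_fin_one,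
      map_div₀, map_one, conj_ofReal, Fin.val_zero, Fin.val_one, pow_zero, pow_one, ite_self,
      one_mul, flipSign]
    have e1 : ∀ w : ℂ, 1 / (Real.sqrt 2 : ℂ) * (1 / Real.sqrt 2) +
        conj (I ^ v l) / Real.sqrt 2 * (w * (I ^ v' l / Real.sqrt 2)) =
        (1 + w * (conj (I ^ v l) * I ^ v' l)) / 2 := fun w => by
      rw [← h2]; field_simp
    rw [e1, e]
    by_cases hl : l = n
    · rcases hs with h | h <;> rw [h] <;> simp [hl]
    · rcases hs with h | h <;> rw [h] <;> simp [hl]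
  have hprod : (∏ l, ∑ t : Fin 2, conj (localState (v l) t) *
      ((if l = n then (-1) ^ (t : ℕ) else 1) * localState (v' l) t)) =
      if ∀ l, chiralSign κ S l * chiralSign κ' S' l = flipSign n l then 1 else 0 := by
    simp only [hloc]
    split_ifs with h
    · exact Finset.prod_eq_one fun l _ => if_pos (h l)
    · push Not at h
      obtain ⟨l, hl⟩ := h
      exact Finset.prod_eq_zero (Finset.mem_univ l) (if_neg hl)
  rw [← hprod, Finset.prod_univ_sum, dotProduct, Fintype.piFinset_univ, Finset.mul_sum]
  refine Finset.sum_congr rfl fun s _ => ?_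
  rw [sigma_z_mulVec, Pi.star_apply]
  simp only [chiralVector, star_def, map_mul, map_pow, map_neg, conj_I, neg_neg,
    map_prod]
  rw [Finset.prod_mul_distrib, Finset.prod_mul_distrib]
  have : (∏ l, if l = n then (-1 : ℂ) ^ (s l : ℕ) else 1) = (-1) ^ (s n : ℕ) := by
    rw [Finset.prod_ite_eq' Finset.univ n]
    simp
  rw [this]
  ring

/-! ### Kink combinatorics of a spin flip -/

/-- `-1` if the site `x` carries a kink, and `1` otherwise. -/
def kinkSign {N M : ℕ} (S : Fin M → Fin N) (x : Fin N) : ℤ := if ∃ j, S j = x then -1 else 1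

/-- The parity of the number of kinks at positions less than `t`. -/
def kinkParity {N M : ℕ} (S : Fin M → Fin N) (t : ℕ) : ℤ :=
  (-1) ^ (Finset.univ.filter fun j => (S j : ℕ) < t).card

lemma chiralSign_eq {N M : ℕ} (κ : ℤ) (S : Fin M → Fin N) (l : Fin N) :
    chiralSign κ S l = κ * kinkParity S l := rfl

lemma kinkParity_zero {N M : ℕ} (S : Fin M → Fin N) : kinkParity S 0 = 1 := by
  simp [kinkParity]

lemma kinkParity_length {N M : ℕ} (S : Fin M → Fin N) : kinkParity S N = (-1) ^ M := by
  simp [kinkParity]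

lemma kinkParity_succ {N M : ℕ} {S : Fin M → Fin N} (hS : Function.Injective S) (x : Fin N) :
    kinkParity S ((x : ℕ) + 1) = kinkParity S x * kinkSign S x := by
  have e : (Finset.univ.filter fun j => (S j : ℕ) < (x : ℕ) + 1) =
      (Finset.univ.filter fun j => (S j : ℕ) < x) ∪ Finset.univ.filter fun j => S j = x := by
    ext j
    simp only [Finset.mem_filter, Finset.mem_univ, true_and, Finset.mem_union, Fin.ext_iff]
    omega
  have d : Disjoint (Finset.univ.filter fun j => (S j : ℕ) < x)
      (Finset.univ.filter fun j => S j = x) := by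
    rw [Finset.disjoint_filter]
    intro j _ h1 h2
    rw [h2] at h1
    exact lt_irrefl _ h1
  rw [kinkParity, e, Finset.card_union_of_disjoint d, pow_add, ← kinkParity, kinkSign]
  congr 1
  split_ifs with h
  · obtain ⟨j, hj⟩ := h
    have : (Finset.univ.filter fun j => S j = x) = {j} := by
      ext i
      simp only [Finset.mem_filter, Finset.mem_univ, true_and, Finset.mem_singleton]
      exact ⟨fun h => hS (h.trans hj.symm), fun h => h ▸ hj⟩
    rw [this, Finset.card_singleton, pow_one]
  · have : (Finset.univ.filter fun j => S j = x) = ∅ :=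
      Finset.filter_eq_empty_iff.2 fun j _ hj => h ⟨j, hj⟩
    rw [this, Finset.card_empty, pow_zero]

lemma flipSign_mul_self {N : ℕ} (n x : Fin N) : flipSign n x * flipSign n x = 1 := by
  rw [flipSign]; split_ifs <;> norm_num

/-- A sign flipped only at n changes across exactly two bonds of the ring: from m to n, and from n
to its successor. -/
lemma IsPrev.flipSign_mul {N : ℕ} {m n x y : Fin N} (hmn : IsPrev m n) (hne : m ≠ n)
    (hxy : IsPrev x y) : flipSign n x * flipSign n y = if x = m ∨ x = n then -1 else 1 := by
  have h : y = n ↔ x = m := by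
    have hx := x.2
    have hm := m.2
    simp only [Fin.ext_iff]
    rcases hmn with h1 | h1 <;> rcases hxy with h2 | h2 <;> omega
  simp only [flipSign, h]
  by_cases h1 : x = m
  · simp [h1, hne]
  · simp [h1]

lemma exists_isPrev {N : ℕ} (x : Fin N) : ∃ y, IsPrev x y := by
  by_cases h : (x : ℕ) + 1 < N
  · exact ⟨⟨x + 1, h⟩, Or.inl rfl⟩
  · exact ⟨⟨0, Fin.pos x⟩, Or.inr ⟨rfl, by omega⟩⟩

/-- Two chiral basis vectors differ by a spin flip at `n` exactly if their kink sets differ by the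
sites `n` and its predecessor. -/
lemma chiralSign_mul_eq_flipSign_iff {N M : ℕ} {κ κ' : ℤ} {S S' : Fin M → Fin N}
    (hS : Function.Injective S) (hS' : Function.Injective S') {m n : Fin N}
    (hmn : IsPrev m n) (hne : m ≠ n) :
    (∀ l, chiralSign κ S l * chiralSign κ' S' l = flipSign n l) ↔
      κ * κ' = (if (n : ℕ) = 0 then -1 else 1) ∧
        ∀ x, kinkSign S x * kinkSign S' x = if x = m ∨ x = n then -1 else 1 := by
  simp only [chiralSign_eq]
  set z : Fin N := ⟨0, Fin.pos n⟩ with hz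
  have hfz : flipSign n z = if (n : ℕ) = 0 then -1 else 1 := by
    rw [flipSign]
    simp only [hz, Fin.ext_iff, eq_comm]
  rw [← hfz]
  constructor
  · intro H
    have h0 : κ * κ' = flipSign n z := by
      have := H z
      simp only [hz, kinkParity_zero] at this
      linear_combination this
    refine ⟨h0, fun x => ?_⟩
    obtain ⟨y, hxy⟩ := exists_isPrev x
    rw [← hmn.flipSign_mul hne hxy]
    have hx := H x
    have fx := flipSign_mul_self n x
    have key : flipSign n x * (kinkSign S x * kinkSign S' x) = flipSign n y := by
      rcases hxy with h | ⟨h1, h2⟩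
      · have hy := H y
        rw [← h, kinkParity_succ hS, kinkParity_succ hS'] at hy
        rw [← hx, ← hy]; ring
      -- On the bond closing the ring, both kink parities have become (-1)^M, so their product is 1
      -- and the relative sign returns to κκ'.
      · have hy : y = z := Fin.ext h1
        have p := kinkParity_succ hS x
        have p' := kinkParity_succ hS' x
        rw [h2, kinkParity_length] at p p'
        have e : kinkParity S x * kinkSign S x * (kinkParity S' x * kinkSign S' x) = 1 := by
          rw [← p, ← p', ← mul_pow]; simp
        rw [hy, ← h0, ← hx]
        linear_combination κ * κ' * e
    calc _ = flipSign n x * flipSign n x * (kinkSign S x * kinkSign S' x) := by rw [fx, one_mul]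
      _ = _ := by rw [mul_assoc, key]
  · rintro ⟨h0, H⟩
    have ind : ∀ t (ht : t < N), kinkParity S t * kinkParity S' t =
        flipSign n z * flipSign n ⟨t, ht⟩ := by
      intro t
      induction t with
      | zero =>
        intro ht
        rw [kinkParity_zero, kinkParity_zero, flipSign_mul_self]; norm_num
      | succ t ih =>
        intro ht
        have ht' : t < N := by omega
        have e := H ⟨t, ht'⟩
        rw [← hmn.flipSign_mul hne (x := ⟨t, ht'⟩) (y := ⟨t + 1, ht⟩) (Or.inl rfl)] at e
        have i := ih ht'
        have f := flipSign_mul_self n ⟨t, ht'⟩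
        have p := kinkParity_succ hS ⟨t, ht'⟩
        have p' := kinkParity_succ hS' ⟨t, ht'⟩
        simp only at p p'
        rw [p, p']
        linear_combination (kinkSign S ⟨t, ht'⟩ * kinkSign S' ⟨t, ht'⟩) * i +
          (flipSign n z * flipSign n ⟨t, ht'⟩) * e +
          (flipSign n z * flipSign n ⟨t + 1, ht⟩) * f
    intro l
    have i := ind l l.2
    have f := flipSign_mul_self n z
    linear_combination (kinkParity S l * kinkParity S' l) * h0 + flipSign n z * i + flipSign n l * f

lemma kinkSign_mul_eq_iff {N M : ℕ} {S S' : Fin M → Fin N} {m n x : Fin N} :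
    (kinkSign S x * kinkSign S' x = if x = m ∨ x = n then -1 else 1) ↔
      ((∃ j, S' j = x) ↔ ¬ ((∃ j, S j = x) ↔ (x = m ∨ x = n))) := by
  unfold kinkSign
  by_cases h1 : ∃ j, S j = x <;> by_cases h2 : ∃ j, S' j = x <;> by_cases h3 : x = m ∨ x = n <;>
    simp only [h1, h2, h3, if_true, if_false] <;> simp

/-- Moving the kink at `n` to the empty preceding site, and sorting. -/
lemma exists_strictMono_update {N M : ℕ} {S : Fin M → Fin N} (hS : StrictMono S) {m n : Fin N}
    (hmn : IsPrev m n) {j : Fin M} (hj : S j = n) (hm : ∀ i, S i ≠ m) :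
    ∃ ρ : Equiv.Perm (Fin M), StrictMono (Function.update S j m ∘ ρ) ∧
      ((Equiv.Perm.sign ρ : ℤ) = if (n : ℕ) = 0 then (-1) ^ (M - 1) else 1) := by
  rcases hmn with h | ⟨h0, h1⟩
  · refine ⟨1, ?_, by rw [if_neg (by omega)]; simp⟩
    rw [Equiv.Perm.coe_one, Function.comp_id]
    intro a b hab
    have hlt := hS hab
    have hma := Fin.val_ne_of_ne (hm a)
    rw [Fin.lt_def] at hlt ⊢
    by_cases ha : a = j
    · have hb : b ≠ j := fun hb => hab.ne (ha.trans hb.symm)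
      rw [ha, Function.update_self, Function.update_of_ne hb]
      rw [ha, hj] at hlt
      omega
    · by_cases hb : b = j
      · rw [hb, Function.update_self, Function.update_of_ne ha]
        rw [hb, hj] at hlt
        omega
      · rwa [Function.update_of_ne ha, Function.update_of_ne hb]
  · obtain ⟨M, rfl⟩ : ∃ M', M = M' + 1 := ⟨M - 1, by have := j.2; omega⟩
    -- The kink at the first site has index 0 and moves to the last site, so sorting is a cyclic
    -- rotation of all the kinks.
    refine ⟨finRotate (M + 1), ?_, ?_⟩
    · have hj0 : j = 0 := by
        by_contra hne
        have := hS (Fin.pos_of_ne_zero hne)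
        rw [hj, Fin.lt_def] at this
        omega
      subst hj0
      intro a b hab
      have ha : a ≠ Fin.last M := (hab.trans_le (Fin.le_last b)).ne
      have ha' : finRotate (M + 1) a ≠ 0 := by
        rw [← finRotate_last]
        exact fun h => ha ((finRotate _).injective h)
      simp only [Function.comp]
      rw [Function.update_of_ne ha']
      by_cases hb : b = Fin.last M
      · rw [hb, finRotate_last, Function.update_self]
        refine lt_of_le_of_ne ?_ (hm _)
        rw [Fin.le_def]
        have := (S (finRotate (M + 1) a)).2
        omega
      · have hb' : finRotate (M + 1) b ≠ 0 := by
          rw [← finRotate_last]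
          exact fun h => hb ((finRotate _).injective h)
        rw [Function.update_of_ne hb']
        apply hS
        rw [Fin.lt_def, coe_finRotate_of_ne_last ha, coe_finRotate_of_ne_last hb]
        exact Nat.add_lt_add_right hab 1
    · rw [if_pos h0, sign_finRotate]; push_cast; rfl

lemma exists_update_comp_eq_iff {N M : ℕ} {S : Fin M → Fin N} (hS : Function.Injective S)
    {m n : Fin N} {j : Fin M} (hj : S j = n) (ρ : Equiv.Perm (Fin M)) (x : Fin N) :
    (∃ i, (Function.update S j m ∘ ρ) i = x) ↔ x = m ∨ ((∃ i, S i = x) ∧ x ≠ n) := by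
  constructor
  · rintro ⟨i, rfl⟩
    simp only [Function.comp]
    by_cases h : ρ i = j
    · left; rw [h, Function.update_self]
    · right
      rw [Function.update_of_ne h]
      exact ⟨⟨_, rfl⟩, fun e => h (hS (e.trans hj.symm))⟩
  · rintro (rfl | ⟨⟨i, rfl⟩, h⟩)
    · exact ⟨ρ⁻¹ j, by simp⟩
    · have : i ≠ j := fun e => h (e ▸ hj)
      exact ⟨ρ⁻¹ i, by simp [this]⟩

/-- Toggling two occupied sites would leave two kinks fewer, whereas both tuples have M of them. -/
lemma not_forall_kinkSign_of_mem {N M : ℕ} {S S' : Fin M → Fin N} (hS : Function.Injective S)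
    (hS' : Function.Injective S') {m n : Fin N} (hne : m ≠ n) (hn : ∃ j, S j = n)
    (hm : ∃ j, S j = m) :
    ¬ ∀ x, kinkSign S x * kinkSign S' x = if x = m ∨ x = n then -1 else 1 := by
  intro H
  have e : Finset.univ.image S' = ((Finset.univ.image S).erase n).erase m := by
    ext x
    have := kinkSign_mul_eq_iff.1 (H x)
    simp only [Finset.mem_image, Finset.mem_univ, true_and, Finset.mem_erase]
    rw [this]
    by_cases h1 : x = m
    · subst h1; simp [hm]
    · by_cases h2 : x = n
      · subst h2; simp [hn]
      · simp [h1, h2]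
  have := congrArg Finset.card e
  rw [Finset.card_image_of_injective _ hS', Finset.card_erase_of_mem, Finset.card_erase_of_mem,
    Finset.card_image_of_injective _ hS, Finset.card_fin] at this
  · obtain ⟨j, hj⟩ := hn
    have := j.2
    omega
  · simpa using hn
  · simpa [hne] using hm

lemma forall_kinkSign_iff_eq {N M : ℕ} {S S' : Fin M → Fin N} (hS : Function.Injective S)
    (hS' : StrictMono S') {m n : Fin N} (hne : m ≠ n) {j : Fin M} (hj : S j = n)
    (hm : ∀ i, S i ≠ m) {ρ : Equiv.Perm (Fin M)} (hρ : StrictMono (Function.update S j m ∘ ρ)) :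
    (∀ x, kinkSign S x * kinkSign S' x = if x = m ∨ x = n then -1 else 1) ↔
      S' = Function.update S j m ∘ ρ := by
  have hm' : ¬ ∃ i, S i = m := by simpa using hm
  have aux : ∀ x, (x = m ∨ ((∃ i, S i = x) ∧ x ≠ n)) ↔ ¬ ((∃ i, S i = x) ↔ (x = m ∨ x = n)) := by
    intro x
    by_cases h1 : x = m
    · subst h1; simp [hm']
    · by_cases h2 : x = n
      · subst h2; simp [h1, show ∃ i, S i = x from ⟨j, hj⟩]
      · simp [h1, h2]
  simp only [kinkSign_mul_eq_iff]
  constructor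
  · intro H
    rw [← StrictMono.range_inj hS' hρ]
    ext x
    rw [Set.mem_range, Set.mem_range, H x, exists_update_comp_eq_iff hS hj, aux]
  · rintro rfl x
    rw [exists_update_comp_eq_iff hS hj, aux]

/-! ### The magnetization as a free-fermion hopping expectation -/

/-- The matrix element of `A` between two chiral basis vectors. -/
noncomputable def chiralElement {N M : ℕ} (A : Matrix (Fin N → Fin 2) (Fin N → Fin 2) ℂ)
    (p q : (Fin M → Fin N) × ℤ) : ℂ :=
  star (chiralVector p.2 p.1) ⬝ᵥ A.mulVec (chiralVector q.2 q.1)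

open Classical in
/-- The labels `(n, κ)` of the chiral basis vectors with `M` kinks. -/
def chiralIndex (N M : ℕ) : Finset ((Fin M → Fin N) × ℤ) :=
  (Finset.univ : Finset (Fin M → Fin N)).filter (fun n => StrictMono n) ×ˢ {1, -1}

lemma mem_chiralIndex {N M : ℕ} {p : (Fin M → Fin N) × ℤ} :
    p ∈ chiralIndex N M ↔ StrictMono p.1 ∧ (p.2 = 1 ∨ p.2 = -1) := by
  simp [chiralIndex]

lemma expectation_betheVector {N M : ℕ} (τ : ℂ) (ξ : ℕ) (u : Fin M → ℂ)
    (A : Matrix (Fin N → Fin 2) (Fin N → Fin 2) ℂ) :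
    expectation A (betheVector τ N ξ u) = ∑ p ∈ chiralIndex N M, ∑ q ∈ chiralIndex N M,
      conj (chi τ u p.1 * (p.2 : ℂ) ^ ξ) * (chi τ u q.1 * (q.2 : ℂ) ^ ξ) *
        chiralElement A p q := by
  have e : betheVector τ N ξ u = ∑ p ∈ chiralIndex N M,
      (chi τ u p.1 * (p.2 : ℂ) ^ ξ) • chiralVector p.2 p.1 := by
    rw [chiralIndex, Finset.sum_product]; rfl
  rw [expectation, e, star_sum, sum_dotProduct]
  refine Finset.sum_congr rfl fun p _ => ?_
  rw [Matrix.mulVec_sum, dotProduct_sum]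
  refine Finset.sum_congr rfl fun q _ => ?_
  rw [Matrix.mulVec_smul, star_smul, smul_dotProduct, dotProduct_smul, chiralElement,
    starRingEnd_apply, smul_eq_mul, smul_eq_mul]
  ring

open Classical in
lemma chiralElement_sigma_z {N M : ℕ} {m n : Fin N} (hmn : IsPrev m n) (hne : m ≠ n)
    {p q : (Fin M → Fin N) × ℤ} (hp : p ∈ chiralIndex N M) (hq : q ∈ chiralIndex N M) :
    chiralElement (sigma Axis.z n) p q =
      I ^ (∑ j, label (p.1 j)) * (-I) ^ (∑ j, label (q.1 j)) *
        if p.2 * q.2 = (if (n : ℕ) = 0 then -1 else 1) ∧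
          ∀ x, kinkSign p.1 x * kinkSign q.1 x = if x = m ∨ x = n then -1 else 1
        then 1 else 0 := by
  rw [mem_chiralIndex] at hp hq
  rw [chiralElement, chiralVector_sigma_z hp.2 hq.2]
  simp only [chiralSign_mul_eq_flipSign_iff hp.1.injective hq.1.injective hmn hne]

open Classical in
lemma conj_chiralElement_sigma_z {N M : ℕ} {m n : Fin N} (hmn : IsPrev m n) (hne : m ≠ n)
    {p q : (Fin M → Fin N) × ℤ} (hp : p ∈ chiralIndex N M) (hq : q ∈ chiralIndex N M) :
    conj (chiralElement (sigma Axis.z n) p q) = chiralElement (sigma Axis.z n) q p := by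
  rw [chiralElement_sigma_z hmn hne hp hq, chiralElement_sigma_z hmn hne hq hp]
  simp only [map_mul, map_pow, map_neg, conj_I, neg_neg, mul_comm (q.2) p.2,
    mul_comm (kinkSign q.1 _)]
  rw [apply_ite conj, map_one, map_zero]
  ring

open Classical in
/-- A nonzero matrix element moves exactly one kink onto or away from the site `n`. -/
lemma chiralElement_sigma_z_eq_add {N M : ℕ} {m n : Fin N} (hmn : IsPrev m n) (hne : m ≠ n)
    {p q : (Fin M → Fin N) × ℤ} (hp : p ∈ chiralIndex N M) (hq : q ∈ chiralIndex N M) :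
    chiralElement (sigma Axis.z n) p q =
      (if ∃ j, p.1 j = n then chiralElement (sigma Axis.z n) p q else 0) +
      (if ∃ j, q.1 j = n then chiralElement (sigma Axis.z n) p q else 0) := by
  by_cases h : ∀ x, kinkSign p.1 x * kinkSign q.1 x = if x = m ∨ x = n then -1 else 1
  · have := kinkSign_mul_eq_iff.1 (h n)
    simp only [or_true, iff_true] at this
    by_cases h1 : ∃ j, p.1 j = n
    · rw [if_pos h1, if_neg (fun h2 => this.1 h2 h1), add_zero]
    · rw [if_neg h1, if_pos (this.2 h1), zero_add]
  · have : chiralElement (sigma Axis.z n) p q = 0 := by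
      rw [chiralElement_sigma_z hmn hne hp hq, if_neg (fun h' => h h'.2), mul_zero]
    simp [this]

/-- Within the chain the phase is just i. Across the boundary, i(-i)^N = i(-1)^(N/2) = i(-1)^M by
the parity condition; re-sorting contributes (-1)^(M-1) and the flip of κ contributes (-1)^ξ. The
total i(-1)^(ξ+1) is the boundary sign of the amplitudes. -/
lemma IsPrev.phase {N M ξ : ℕ} {m n : Fin N} (hmn : IsPrev m n) (hN : Even N)
    (hM : M ≡ N / 2 [MOD 2]) (hM0 : 0 < M) :
    I ^ label n * (-I) ^ label m * (if (n : ℕ) = 0 then (-1) ^ (M - 1) else 1 : ℤ) *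
      ((if (n : ℕ) = 0 then -1 else 1 : ℤ) : ℂ) ^ ξ = I * wrapSign ξ n := by
  have hI : I * -I = 1 := by simp
  rcases hmn with h | ⟨h0, h1⟩
  · have hl : label n = label m + 1 := by simp only [label]; omega
    have h0 : (n : ℕ) ≠ 0 := by omega
    have e : I ^ label m * (-I) ^ label m = 1 := by rw [← mul_pow, hI, one_pow]
    rw [wrapSign, if_neg h0, if_neg h0, if_neg h0, hl, pow_succ]
    push_cast
    rw [one_pow]
    linear_combination I * e
  · have hl : label n = 1 := by simp only [label]; omega
    have hl' : label m = N := h1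
    obtain ⟨K, hK⟩ := hN
    have hp : (-I) ^ N = (-1) ^ M := by
      rw [hK, ← two_mul, pow_mul, neg_sq, I_sq]
      rw [hK, ← two_mul, Nat.mul_div_cancel_left _ two_pos] at hM
      rw [← Nat.div_add_mod K 2, ← Nat.div_add_mod M 2, hM, pow_add, pow_add, pow_mul, pow_mul]
      simp
    obtain ⟨M, rfl⟩ : ∃ M', M = M' + 1 := ⟨M - 1, by omega⟩
    rw [wrapSign, if_pos h0, if_pos h0, if_pos h0, hl, hl', hp, Nat.add_sub_cancel]
    push_cast
    have : ((-1 : ℂ) ^ M) * (-1) ^ M = 1 := by rw [← mul_pow]; simp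
    rw [pow_one, pow_succ (-1 : ℂ) M, pow_succ (-1 : ℂ) ξ]
    linear_combination (-I * (-1) ^ ξ) * this

lemma chi_comp {N M : ℕ} (τ : ℂ) (u : Fin M → ℂ) (T : Fin M → Fin N) (ρ : Equiv.Perm (Fin M)) :
    chi τ u (T ∘ ρ) = (Equiv.Perm.sign ρ : ℤ) * chi τ u T := by
  have : (Matrix.of fun j l : Fin M => amplitude τ ((T ∘ ρ) j) (u l)) =
      (Matrix.of fun j l : Fin M => amplitude τ (T j) (u l)).submatrix ρ id := rfl
  rw [chi, chi, this, Matrix.det_permute]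
  ring

lemma I_pow_mul_neg_I_pow_update {N M : ℕ} (S : Fin M → Fin N) (m : Fin N) (j : Fin M)
    (ρ : Equiv.Perm (Fin M)) :
    I ^ (∑ i, label (S i)) * (-I) ^ (∑ i, label ((Function.update S j m ∘ ρ) i)) =
      I ^ label (S j) * (-I) ^ label m := by
  have hI : I * -I = 1 := by simp
  have e : ∑ i ∈ Finset.univ.erase j, label (Function.update S j m i) =
      ∑ i ∈ Finset.univ.erase j, label (S i) := Finset.sum_congr rfl fun i hi => by
    rw [Function.update_of_ne (Finset.ne_of_mem_erase hi)]
  simp only [Function.comp]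
  rw [Equiv.sum_comp ρ (fun i => label (Function.update S j m i)),
    ← Finset.add_sum_erase _ _ (Finset.mem_univ j),
    ← Finset.add_sum_erase _ (fun i => label (Function.update S j m i)) (Finset.mem_univ j),
    Function.update_self, e, pow_add, pow_add,
    mul_mul_mul_comm, ← mul_pow I (-I) (∑ i ∈ Finset.univ.erase j, label (S i)), hI, one_pow,
    mul_one]

open Classical in
/-- The action of `σ_n^z` on a chiral Bethe vector, projected on a basis vector with a kink
at `n`. -/
lemma sum_chi_mul_chiralElement {N M ξ : ℕ} {m n : Fin N} (hmn : IsPrev m n) (hne : m ≠ n)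
    (hN : Even N) (hM : M ≡ N / 2 [MOD 2]) (τ : ℂ) (u : Fin M → ℂ)
    {p : (Fin M → Fin N) × ℤ} (hp : p ∈ chiralIndex N M) {j : Fin M} (hj : p.1 j = n) :
    ∑ q ∈ chiralIndex N M, chi τ u q.1 * (q.2 : ℂ) ^ ξ * chiralElement (sigma Axis.z n) p q =
      (p.2 : ℂ) ^ ξ * (I * wrapSign ξ n) * chi τ u (Function.update p.1 j m) := by
  obtain ⟨S, κ⟩ := p
  simp only at hj
  have hp' := hp
  rw [mem_chiralIndex] at hp'
  obtain ⟨hS, hκ⟩ := hp'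
  simp only at hS hκ
  by_cases hm : ∃ i, S i = m
  -- If m is already occupied both sides vanish: the determinant has two equal rows, and no M-kink
  -- state is reachable.
  · have h0 : chi τ u (Function.update S j m) = 0 := by
      obtain ⟨i, hi⟩ := hm
      have hij : i ≠ j := by rintro rfl; exact hne (hi.symm.trans hj)
      rw [chi, Matrix.det_zero_of_row_eq hij, mul_zero]
      funext l
      simp [hij, hi]
    rw [h0, mul_zero]
    refine Finset.sum_eq_zero fun q hq => ?_
    rw [chiralElement_sigma_z hmn hne hp hq, if_neg, mul_zero, mul_zero]
    rintro ⟨-, h⟩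
    exact not_forall_kinkSign_of_mem hS.injective (mem_chiralIndex.1 hq).1.injective hne ⟨j, hj⟩
      hm h
  · have hm' : ∀ i, S i ≠ m := by simpa using hm
    obtain ⟨ρ, hρ, hsign⟩ := exists_strictMono_update hS hmn hj hm'
    set T := Function.update S j m with hT
    set κ₀ : ℤ := κ * (if (n : ℕ) = 0 then -1 else 1) with hκ₀
    have hκκ : κ * κ = 1 := by rcases hκ with h | h <;> rw [h] <;> norm_num
    have hq₀ : (T ∘ ρ, κ₀) ∈ chiralIndex N M := by
      rw [mem_chiralIndex]
      refine ⟨hρ, ?_⟩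
      simp only [hκ₀]
      rcases hκ with h | h <;> rw [h] <;> split_ifs <;> norm_num
    have cond : ∀ q ∈ chiralIndex N M,
        (κ * q.2 = (if (n : ℕ) = 0 then -1 else 1) ∧
          ∀ x, kinkSign S x * kinkSign q.1 x = if x = m ∨ x = n then -1 else 1) ↔
        q = (T ∘ ρ, κ₀) := by
      intro q hq
      rw [forall_kinkSign_iff_eq hS.injective (mem_chiralIndex.1 hq).1 hne hj hm' hρ,
        Prod.ext_iff, and_comm]
      refine and_congr Iff.rfl ?_
      simp only [hκ₀]
      constructor
      · intro h; rw [← h]; linear_combination -q.2 * hκκ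
      · intro h; rw [h]; linear_combination (if (n : ℕ) = 0 then -1 else 1) * hκκ
    rw [Finset.sum_eq_single (T ∘ ρ, κ₀)]
    · rw [chiralElement_sigma_z hmn hne hp hq₀, if_pos ((cond _ hq₀).2 rfl), chi_comp, mul_one]
      simp only
      rw [hT, I_pow_mul_neg_I_pow_update, hj, hsign, ← IsPrev.phase hmn hN hM (Fin.pos j), hκ₀,
        Int.cast_mul, mul_pow]
      ring
    · intro q hq hne'
      rw [chiralElement_sigma_z hmn hne hp hq, if_neg (fun h => hne' ((cond q hq).1 h)), mul_zero,
        mul_zero]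
    · exact fun h => absurd hq₀ h

-- This is the half of the expectation in which the bra carries the kink at n. Both values of κ
-- contribute equally, which cancels the 2 in the normalization, while N^M cancels against the Gram
-- determinant of the amplitudes.
open Classical in
lemma sum_hop {N M ξ : ℕ} {m n : Fin N} (hmn : IsPrev m n) (hne : m ≠ n)
    (hN : Even N) (hM : M ≡ N / 2 [MOD 2]) (τ : ℂ) (u : Fin M → ℂ)
    (horth : ∀ l k, ∑ n : Fin N, conj (amplitude τ n (u l)) * amplitude τ n (u k) =
      if l = k then (N : ℂ) else 0) :
    ∑ p ∈ chiralIndex N M, ∑ q ∈ chiralIndex N M,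
      conj (chi τ u p.1 * (p.2 : ℂ) ^ ξ) * (chi τ u q.1 * (q.2 : ℂ) ^ ξ) *
        (if ∃ j, p.1 j = n then chiralElement (sigma Axis.z n) p q else 0) =
      I * wrapSign ξ n * (1 / N * ∑ l, conj (amplitude τ n (u l)) * amplitude τ m (u l)) := by
  have hN0 : 0 < N := Fin.pos n
  have hNC : (N : ℂ) ≠ 0 := by exact_mod_cast hN0.ne'
  set V : Matrix (Fin N) (Fin M) ℂ := Matrix.of fun n l => amplitude τ n (u l) with hV
  have hVV : V.conjTranspose * V = (N : ℂ) • (1 : Matrix (Fin M) (Fin M) ℂ) := by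
    ext l k
    have := horth l k
    simp only [Matrix.mul_apply, Matrix.conjTranspose_apply, hV, Matrix.of_apply,
      Matrix.smul_apply, Matrix.one_apply, smul_eq_mul, mul_ite, mul_one, mul_zero]
    exact this
  set C : ℂ := 1 / (Real.sqrt (2 * (N : ℝ) ^ M) : ℂ) with hC
  have hchi : ∀ T : Fin M → Fin N, chi τ u T = C * (V.submatrix T id).det := fun T => rfl
  have hCC : conj C * C = 1 / (2 * (N : ℂ) ^ M) := by
    have : (Real.sqrt (2 * (N : ℝ) ^ M) : ℂ) * Real.sqrt (2 * (N : ℝ) ^ M) =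
        2 * (N : ℂ) ^ M := by
      rw [← ofReal_mul, Real.mul_self_sqrt (by positivity)]; push_cast; rfl
    rw [hC, map_div₀, map_one, conj_ofReal, div_mul_div_comm, one_mul, this]
  have inner : ∀ p ∈ chiralIndex N M, ∑ q ∈ chiralIndex N M,
      conj (chi τ u p.1 * (p.2 : ℂ) ^ ξ) * (chi τ u q.1 * (q.2 : ℂ) ^ ξ) *
        (if ∃ j, p.1 j = n then chiralElement (sigma Axis.z n) p q else 0) =
      I * wrapSign ξ n * (1 / (2 * (N : ℂ) ^ M)) * (conj (V.submatrix p.1 id).det *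
        ∑ j, if p.1 j = n then (V.submatrix (Function.update p.1 j m) id).det else 0) := by
    intro p hp
    obtain ⟨hS, hκ⟩ := mem_chiralIndex.1 hp
    by_cases h : ∃ j, p.1 j = n
    · obtain ⟨j, hj⟩ := h
      have hκξ : conj ((p.2 : ℂ) ^ ξ) * (p.2 : ℂ) ^ ξ = 1 := by
        rw [map_pow, ← mul_pow]
        rcases hκ with h | h <;> rw [h] <;> simp
      rw [Finset.sum_eq_single j
        (fun i _ hi => if_neg fun h => hi (hS.injective (h.trans hj.symm))) (by simp), if_pos hj]
      simp only [if_pos (show ∃ j, p.1 j = n from ⟨j, hj⟩), mul_assoc, ← Finset.mul_sum]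
      have := sum_chi_mul_chiralElement (ξ := ξ) hmn hne hN hM τ u hp hj
      simp only [mul_assoc] at this
      rw [this, hchi, hchi, ← hCC]
      simp only [map_mul]
      linear_combination (conj C * C * conj (V.submatrix p.1 id).det * I * wrapSign ξ n *
        (V.submatrix (Function.update p.1 j m) id).det) * hκξ
    · have h' : ∀ j, p.1 j ≠ n := by simpa using h
      simp [h']
  rw [Finset.sum_congr rfl inner, ← Finset.mul_sum, chiralIndex, Finset.sum_product]
  simp only [Finset.sum_const, Finset.card_pair (show (1 : ℤ) ≠ -1 by norm_num),
    ← Finset.smul_sum]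
  rw [sum_conj_det_mul_det_update hNC V hVV n m, nsmul_eq_mul]
  simp only [hV, Matrix.of_apply]
  push_cast
  field_simp

lemma exists_isPrev_to {N : ℕ} (hN : Even N) (n : Fin N) : ∃ m, IsPrev m n ∧ m ≠ n := by
  have hn := n.2
  have : 2 ≤ N := by
    obtain ⟨K, hK⟩ := hN
    omega
  by_cases h : (n : ℕ) = 0
  · refine ⟨⟨N - 1, by omega⟩, Or.inr ⟨h, by simp only; omega⟩, ?_⟩
    rw [Ne, Fin.ext_iff]; simp only; omega
  · refine ⟨⟨n - 1, by omega⟩, Or.inl (by simp only; omega), ?_⟩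
    rw [Ne, Fin.ext_iff]; simp only; omega

/-- The magnetization in a chiral eigenstate. -/
theorem expectation_sigma_z {τ : ℂ} (hre : τ.re = 0) (him : 0 < τ.im) {N M ξ : ℕ} (hN : Even N)
    (hM : M ≡ N / 2 [MOD 2]) {u : Fin M → ℂ} (hu : IsBetheTuple τ N ξ u) (n : Fin N) :
    expectation (sigma Axis.z n) (betheVector τ N ξ u) =
      1 / (N : ℂ) * ∑ l, magX τ (u l) (parity n) := by
  classical
  have hN0 : 0 < N := Fin.pos n
  obtain ⟨m, hmn, hne⟩ := exists_isPrev_to hN n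
  have hop := sum_hop (ξ := ξ) hmn hne hN hM τ u (hu.sum_conj_amplitude_mul hre him hN0 hN)
  -- The other half, with the kink at n in the ket, is the complex conjugate because σ^z is
  -- Hermitian.
  have hop' : ∑ p ∈ chiralIndex N M, ∑ q ∈ chiralIndex N M,
      conj (chi τ u p.1 * (p.2 : ℂ) ^ ξ) * (chi τ u q.1 * (q.2 : ℂ) ^ ξ) *
        (if ∃ j, q.1 j = n then chiralElement (sigma Axis.z n) p q else 0) =
      conj (I * wrapSign ξ n *
        (1 / N * ∑ l, conj (amplitude τ n (u l)) * amplitude τ m (u l))) := by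
    rw [← hop, map_sum, Finset.sum_comm]
    refine Finset.sum_congr rfl fun q hq => ?_
    rw [map_sum]
    refine Finset.sum_congr rfl fun p hp => ?_
    split_ifs with h
    · rw [← conj_chiralElement_sigma_z hmn hne hq hp]
      simp only [map_mul, conj_conj]
      ring
    · simp
  have split : expectation (sigma Axis.z n) (betheVector τ N ξ u) =
      I * wrapSign ξ n * (1 / N * ∑ l, conj (amplitude τ n (u l)) * amplitude τ m (u l)) +
      conj (I * wrapSign ξ n *
        (1 / N * ∑ l, conj (amplitude τ n (u l)) * amplitude τ m (u l))) := by
    rw [expectation_betheVector, ← hop', ← hop, ← Finset.sum_add_distrib]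
    refine Finset.sum_congr rfl fun p hp => ?_
    rw [← Finset.sum_add_distrib]
    refine Finset.sum_congr rfl fun q hq => ?_
    rw [← mul_add, ← chiralElement_sigma_z_eq_add hmn hne hp hq]
  have one : I * wrapSign ξ n * (1 / N *
      ∑ l, conj (amplitude τ n (u l)) * amplitude τ m (u l)) =
      1 / N * ∑ l, I * (1 / (r τ (u l) * R τ (u l) ^ parity n)) := by
    rw [mul_left_comm, Finset.mul_sum]
    congr 1
    refine Finset.sum_congr rfl fun l _ => ?_
    obtain ⟨σ, y, hl⟩ := hu.exists_isAxisPoint hre him hN0 l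
    rw [conj_eq_inv_of_norm_eq_one (hl.norm_amplitude hre him (hu.norm_r hN0 l) n), mul_assoc,
      hl.wrapSign_mul_amplitude hre him hN (hu.bethe_eq l) hmn]
  rw [split, one, map_mul, map_div₀, map_one, map_natCast, map_sum, ← mul_add,
    ← Finset.sum_add_distrib]
  congr 1
  refine Finset.sum_congr rfl fun l _ => ?_
  obtain ⟨σ, y, hl⟩ := hu.exists_isAxisPoint hre him hN0 l
  have hr := hu.norm_r hN0 l
  rw [hl.magX_eq hre him hr
    (show parity n = 1 ∨ parity n = -1 from neg_one_pow_eq_or ℤ _)]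
  -- Unimodularity makes the conjugate of iw equal to -i/w, so that the two halves add up to i(w -
  -- 1/w).
  have hw : ‖1 / (r τ (u l) * R τ (u l) ^ parity n)‖ = 1 := by
    rw [norm_div, norm_mul, norm_zpow, hr, hl.norm_R hre him]; simp
  rw [map_mul, conj_I, conj_eq_inv_of_norm_eq_one hw, one_div, inv_inv]
  ring

end XYChain

theorem mainTheorem4 (τ : ℂ) (hτre : τ.re = 0) (hτim : 0 < τ.im)
    (Jx Jy : ℝ) (hJx : (Jx : ℂ) = XYChain.couplingX τ) (hJy : (Jy : ℂ) = XYChain.couplingY τ)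
    (N : ℕ) (hN : 0 < N) (hNeven : Even N) (M : ℕ) (hM : XYChain.Admissible N M)
    (ξ : ℕ) (hξ : ξ = 0 ∨ ξ = 1) (u : Fin M → ℂ) (hu : XYChain.IsBetheTuple τ N ξ u) :
    -- the one-point functions of the transversal components vanish
    (∀ n : Fin N,
      XYChain.expectation (XYChain.sigma XYChain.Axis.x n) (XYChain.betheVector τ N ξ u) = 0 ∧
      XYChain.expectation (XYChain.sigma XYChain.Axis.y n) (XYChain.betheVector τ N ξ u) = 0) ∧
    -- so does every product of an odd number of transversal components
    (∀ (k : ℕ) (site : Fin (2 * k + 1) → Fin N) (α : Fin (2 * k + 1) → XYChain.Axis),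
      (∀ i, α i = XYChain.Axis.x ∨ α i = XYChain.Axis.y) →
      XYChain.expectation (List.ofFn fun i => XYChain.sigma (α i) (site i)).prod
        (XYChain.betheVector τ N ξ u) = 0) ∧
    -- the quasi-momenta are real solutions of `exp (i p) = r(u)`,
    -- and the two expressions for `𝒳` agree
    (∀ l, Complex.exp (Complex.I * (XYChain.momentum τ (u l) : ℂ)) = XYChain.r τ (u l)) ∧
    (∀ l, ∀ ε : ℤ, ε = 1 ∨ ε = -1 →
      XYChain.magX τ (u l) ε =
        Complex.I * (1 / (XYChain.r τ (u l) * XYChain.R τ (u l) ^ ε) -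
          XYChain.r τ (u l) * XYChain.R τ (u l) ^ ε)) ∧
    -- the magnetization
    (∀ n : Fin N,
      XYChain.expectation (XYChain.sigma XYChain.Axis.z n) (XYChain.betheVector τ N ξ u) =
        1 / (N : ℂ) * ∑ l, XYChain.magX τ (u l) (XYChain.parity n)) ∧
    (∀ n : Fin N,
      XYChain.expectation (XYChain.sigma XYChain.Axis.z n) (XYChain.betheVector τ N ξ u) =
        ((Jy ^ XYChain.parity n / (N : ℝ) *
          ∑ l, XYChain.bandSign (XYChain.momentum τ (u l)) *
            (Real.sin (2 * XYChain.momentum τ (u l)) /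
              Real.sqrt (Real.cos (XYChain.momentum τ (u l)) ^ 2 + ((Jx - Jy) / 2) ^ 2)) : ℝ) : ℂ)) ∧
    -- it depends only on the parity of the site label
    (∀ n m : Fin N, XYChain.label n ≡ XYChain.label m [MOD 2] →
      XYChain.expectation (XYChain.sigma XYChain.Axis.z n) (XYChain.betheVector τ N ξ u) =
        XYChain.expectation (XYChain.sigma XYChain.Axis.z m) (XYChain.betheVector τ N ξ u)) := by
  classical
  have hM2 := hM.2
  have hP : ∀ (n : Fin N) (α : XYChain.Axis), (α = XYChain.Axis.x ∨ α = XYChain.Axis.y) →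
      XYChain.expectation (XYChain.sigma α n) (XYChain.betheVector τ N ξ u) = 0 := fun n α hα =>
    XYChain.expectation_eq_zero_of_spinParity fun s t h =>
      XYChain.spinParity_of_sigma_ne_zero hα h
  have hZ := XYChain.expectation_sigma_z hτre hτim hNeven hM2 hu
  refine ⟨fun n => ⟨hP n _ (Or.inl rfl), hP n _ (Or.inr rfl)⟩, ?_, ?_, ?_, hZ, ?_, ?_⟩
  · intro k site α hα
    refine XYChain.expectation_eq_zero_of_spinParity fun s t h => ?_
    have := XYChain.spinParity_of_prod_ne_zero _ (fun A hA s t h => by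
      obtain ⟨i, rfl⟩ := (List.mem_ofFn' _ _).1 hA
      exact XYChain.spinParity_of_sigma_ne_zero (hα i) h) h
    rw [this, List.length_ofFn, pow_succ, pow_mul]
    simp
  · exact fun l => XYChain.exp_momentum (hu.norm_r hN l)
  · intro l ε hε
    obtain ⟨σ, y, hl⟩ := hu.exists_isAxisPoint hτre hτim hN l
    exact hl.magX_eq hτre hτim (hu.norm_r hN l) hε
  · intro n
    rw [hZ, Finset.mul_sum, Finset.mul_sum, Complex.ofReal_sum]
    refine Finset.sum_congr rfl fun l _ => ?_
    obtain ⟨σ, y, hl⟩ := hu.exists_isAxisPoint hτre hτim hN l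
    rw [hl.magX_eq_real hτre hτim (hu.norm_r hN l) hJx hJy]
    push_cast
    ring
  · intro n m h
    have : XYChain.parity n = XYChain.parity m := by
      rw [XYChain.parity, XYChain.parity, neg_one_pow_eq_pow_mod_two, h,
        ← neg_one_pow_eq_pow_mod_two]
    rw [hZ, hZ, this]
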